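/- **Theorem.** Let $H$ be a separable real Hilbert space, let $Q$ be a bounded selfadjoint nonnegative operator on $H$, and let $(S(t))_{t\ge 0}$ be a $C_0$-semigroup of bounded operators on $H$, with generator $A$. Assume that $$\int_0^\infty \operatorname{tr}\bigl(S(s)QS^*(s)\bigr)\,ds<\infty ,$$ and that the operator $Q_\infty=\int_0^\infty S(s)QS^*(s)\,ds$ is injective. Let $W$ be a standard cylindrical Wiener process on $H$, let $$Z(t,x)=S(t)x+\int_0^t S(t-s)Q^{1/2}\,dW(s),\qquad t\ge 0,\ x\in H,$$ be the Ornstein–Uhlenbeck process solving $dZ=AZ\,dt+Q^{1/2}\,dW$, $Z(0)=x$, and let $R_t\phi(x)=\mathbb E\,\phi(Z(t,x))$ (for $\phi$ bounded and Borel) be its transition semigroup. Let $\mu$ be the centered Gaussian measure on $H$ with covariance operator $Q_\infty$ (it is invariant for $Z$), and denote also by $R_t$ the extension of $R_t$ to a bounded operator on $L^2(H,\mu)$. Then $R_t$ is symmetric in $L^2(H,\mu)$ for every $t\ge 0$ if and only if the following three conditions hold: 1. $Q$ is injective; 2. $S(t)Q^{1/2}(H)\subset Q^{1/2}(H)$ for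 every $t\ge 0$; 3. the family of operators $S_Q(t)=Q^{-1/2}S(t)Q^{1/2}$, $t\ge 0$, is a $C_0$-semigroup of bounded symmetric contractions on $H$. -/

import Mathlib

open MeasureTheory ProbabilityTheory Filter Topology
open scoped InnerProductSpace NNReal ENNReal

set_option linter.unusedSectionVars false

noncomputable section

namespace OrnsteinUhlenbeck

section SquareRoot

/-! ### The positive square root of a positive operator on a real Hilbert space

It is obtained from the power series of `1 - √(1 - z)`, whose coefficients are
`catalan n / 2 ^ (2 n + 1)`. -/

/-- The coefficient of `z ^ (n + 1)` in `1 - √(1 - z)`. -/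
def sqrtCoeff (n : ℕ) : ℝ := catalan n / (2 * 4 ^ n)

theorem sqrtCoeff_nonneg (n : ℕ) : 0 ≤ sqrtCoeff n := by
  unfold sqrtCoeff; positivity

theorem sum_range_sqrtCoeff (N : ℕ) :
    ∑ n ∈ Finset.range N, sqrtCoeff n = 1 - (N.centralBinom : ℝ) / 4 ^ N := by
  induction N with
  | zero => simp
  | succ N ih =>
    rw [Finset.sum_range_succ, ih, sqrtCoeff]
    have h1 : ((N : ℝ) + 1) * catalan N = N.centralBinom := by
      exact_mod_cast succ_mul_catalan_eq_centralBinom N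
    have h2 : ((N : ℝ) + 1) * (N + 1).centralBinom = 2 * (2 * N + 1) * N.centralBinom := by
      exact_mod_cast Nat.succ_mul_centralBinom_succ N
    have h3 : ((N : ℝ) + 1) ≠ 0 := by positivity
    have h4 : ((N + 1).centralBinom : ℝ) = 2 * (2 * N + 1) * catalan N := by
      rw [← h1] at h2
      apply mul_left_cancel₀ h3
      rw [h2]; ring
    rw [h4, ← h1, pow_succ]
    field_simp
    ring

theorem summable_sqrtCoeff : Summable sqrtCoeff :=
  summable_of_sum_range_le (c := 1) sqrtCoeff_nonneg fun N => by
    rw [sum_range_sqrtCoeff]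
    have : (0 : ℝ) ≤ (N.centralBinom : ℝ) / 4 ^ N := by positivity
    linarith

theorem tsum_sqrtCoeff_le : ∑' n, sqrtCoeff n ≤ 1 :=
  Real.tsum_le_of_sum_range_le sqrtCoeff_nonneg fun N => by
    rw [sum_range_sqrtCoeff]
    have : (0 : ℝ) ≤ (N.centralBinom : ℝ) / 4 ^ N := by positivity
    linarith

theorem sum_antidiagonal_sqrtCoeff (n : ℕ) :
    ∑ p ∈ Finset.HasAntidiagonal.antidiagonal n, sqrtCoeff p.1 * sqrtCoeff p.2 =
      2 * sqrtCoeff (n + 1) := by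
  have h : ∀ p ∈ Finset.HasAntidiagonal.antidiagonal n, sqrtCoeff p.1 * sqrtCoeff p.2 =
      (catalan p.1 * catalan p.2 : ℝ) / (4 * 4 ^ n) := by
    intro p hp
    rw [Finset.HasAntidiagonal.mem_antidiagonal] at hp
    unfold sqrtCoeff
    rw [← hp, pow_add]
    field_simp
    norm_num
    ring
  rw [Finset.sum_congr rfl h, ← Finset.sum_div, sqrtCoeff, catalan_succ']
  push_cast
  rw [pow_succ]
  field_simp

variable {H : Type*} [NormedAddCommGroup H] [InnerProductSpace ℝ H] [CompleteSpace H]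

theorem symm_pow {B : H →L[ℝ] H} (hB : (B : H →ₗ[ℝ] H).IsSymmetric) (n : ℕ) (x y : H) :
    ⟪(B ^ n) x, y⟫_ℝ = ⟪x, (B ^ n) y⟫_ℝ := by
  induction n generalizing x y with
  | zero => simp
  | succ n ih =>
    rw [pow_succ, mul_apply_eq_comp, ih, ← pow_succ, pow_succ', mul_apply_eq_comp]
    exact hB _ _

theorem symm_of_hasSum {f : ℕ → H →L[ℝ] H} {F : H →L[ℝ] H} (hs : HasSum f F)
    (hf : ∀ n x y, ⟪f n x, y⟫_ℝ = ⟪x, f n y⟫_ℝ) (x y : H) : ⟪F x, y⟫_ℝ = ⟪x, F y⟫_ℝ := by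
  have e : ∀ z, HasSum (fun n => f n z) (F z) := fun z =>
    hs.mapL (ContinuousLinearMap.apply ℝ H z)
  have e1 : HasSum (fun n => ⟪y, f n x⟫_ℝ) ⟪y, F x⟫_ℝ := (e x).mapL (innerSL ℝ y)
  have e2 : HasSum (fun n => ⟪x, f n y⟫_ℝ) ⟪x, F y⟫_ℝ := (e y).mapL (innerSL ℝ x)
  rw [real_inner_comm]
  refine e1.unique ?_
  have : (fun n => ⟪y, f n x⟫_ℝ) = fun n => ⟪x, f n y⟫_ℝ := by
    funext n; rw [real_inner_comm, hf]
  rw [this]; exact e2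

theorem exists_sqrt_of_norm_le_one {B : H →L[ℝ] H} (hB : (B : H →ₗ[ℝ] H).IsSymmetric)
    (hn : ‖B‖ ≤ 1) : ∃ R : H →L[ℝ] H, R.IsPositive ∧ R * R = 1 - B := by
  set f : ℕ → H →L[ℝ] H := fun n => sqrtCoeff n • B ^ (n + 1) with hf
  have hnorm : ∀ n, ‖f n‖ ≤ sqrtCoeff n := by
    intro n
    rw [hf]
    simp only [norm_smul, Real.norm_eq_abs, abs_of_nonneg (sqrtCoeff_nonneg n)]
    refine mul_le_of_le_one_right (sqrtCoeff_nonneg n) ?_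
    exact (norm_pow_le' B n.succ_pos).trans (pow_le_one₀ (norm_nonneg _) hn)
  have hsn : Summable fun n => ‖f n‖ :=
    Summable.of_nonneg_of_le (fun _ => norm_nonneg _) hnorm summable_sqrtCoeff
  have hs : Summable f := hsn.of_norm
  set F := ∑' n, f n with hF
  have hFF : F * F = 2 • F - B := by
    rw [hF, tsum_mul_tsum_eq_tsum_sum_antidiagonal_of_summable_norm hsn hsn,
      hs.tsum_eq_zero_add]
    have h0 : f 0 = (1 / 2 : ℝ) • B := by simp [hf, sqrtCoeff]
    have h1 : ∀ n, ∑ p ∈ Finset.HasAntidiagonal.antidiagonal n, f p.1 * f p.2 = (2 : ℝ) • f (n + 1) := by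
      intro n
      have : ∀ p ∈ Finset.HasAntidiagonal.antidiagonal n, f p.1 * f p.2 =
          (sqrtCoeff p.1 * sqrtCoeff p.2) • B ^ (n + 2) := by
        intro p hp
        rw [Finset.HasAntidiagonal.mem_antidiagonal] at hp
        simp only [hf]
        rw [smul_mul_smul_comm, ← pow_add, ← hp]
        congr 2; ring
      rw [Finset.sum_congr rfl this, ← Finset.sum_smul, sum_antidiagonal_sqrtCoeff, mul_smul]
    simp_rw [h1]
    rw [tsum_const_smul'' (2 : ℝ), h0]
    module
  have hFnorm : ‖F‖ ≤ 1 :=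
    (tsum_of_norm_bounded summable_sqrtCoeff.hasSum hnorm).trans tsum_sqrtCoeff_le
  have hsymm : ∀ x y, ⟪F x, y⟫_ℝ = ⟪x, F y⟫_ℝ :=
    symm_of_hasSum hs.hasSum fun n x y => by
      simp only [hf, smul_apply, real_inner_smul_left, real_inner_smul_right, symm_pow hB]
  refine ⟨1 - F, ?_, ?_⟩
  · rw [ContinuousLinearMap.isPositive_def]
    refine ⟨fun x y => ?_, fun x => ?_⟩
    · simp [inner_sub_left, inner_sub_right, hsymm]
    · have h1 : ⟪F x, x⟫_ℝ ≤ ‖x‖ ^ 2 := by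
        calc ⟪F x, x⟫_ℝ ≤ ‖F x‖ * ‖x‖ := real_inner_le_norm _ _
          _ ≤ (1 * ‖x‖) * ‖x‖ := by
            gcongr; exact F.le_of_opNorm_le hFnorm x
          _ = ‖x‖ ^ 2 := by ring
      simp [ContinuousLinearMap.reApplyInnerSelf, inner_sub_left]
      exact h1
  · have : (1 - F) * (1 - F) = 1 - 2 • F + F * F := by noncomm_ring
    rw [this, hFF]; abel

theorem norm_one_sub_le {T : H →L[ℝ] H} (hT : T.IsPositive) (hn : ‖T‖ ≤ 1) : ‖1 - T‖ ≤ 1 := by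
  refine ContinuousLinearMap.opNorm_le_bound _ zero_le_one fun x => ?_
  have hs : ∀ x y, ⟪T x, y⟫_ℝ = ⟪x, T y⟫_ℝ := fun x y => hT.inner_left_eq_inner_right x y
  have h1 : 0 ≤ ⟪T (x - T x), x - T x⟫_ℝ := hT.inner_nonneg_left _
  have h2 : ⟪T (T x), T x⟫_ℝ ≤ ‖T x‖ ^ 2 := by
    calc ⟪T (T x), T x⟫_ℝ ≤ ‖T (T x)‖ * ‖T x‖ := real_inner_le_norm _ _
      _ ≤ (1 * ‖T x‖) * ‖T x‖ := by gcongr; exact T.le_of_opNorm_le hn _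
      _ = ‖T x‖ ^ 2 := by ring
  rw [map_sub, inner_sub_left, inner_sub_right, inner_sub_right, hs (T x) x,
    real_inner_self_eq_norm_sq] at h1
  have h3 : 0 ≤ ⟪T x, x⟫_ℝ := hT.inner_nonneg_left x
  rw [one_mul]
  refine le_of_sq_le_sq ?_ (norm_nonneg _)
  rw [sub_apply, one_apply_eq_self, norm_sub_sq_real,
    real_inner_comm]
  linarith

theorem exists_sqrt {Q : H →L[ℝ] H} (hQ : Q.IsPositive) :
    ∃ R : H →L[ℝ] H, R.IsPositive ∧ R * R = Q := by
  have hc : 0 < ‖Q‖ + 1 := by positivity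
  set c := ‖Q‖ + 1 with hcdef
  have hT : (c⁻¹ • Q).IsPositive := hQ.smul_of_nonneg (by positivity)
  have hTn : ‖c⁻¹ • Q‖ ≤ 1 := by
    rw [norm_smul, Real.norm_eq_abs, abs_of_nonneg (by positivity), inv_mul_le_iff₀ hc]
    linarith
  obtain ⟨R, hR, hRR⟩ := exists_sqrt_of_norm_le_one (B := 1 - c⁻¹ • Q)
    (fun x y => by
      have := hT.inner_left_eq_inner_right x y
      simp only [ContinuousLinearMap.coe_coe, sub_apply,
        one_apply_eq_self, inner_sub_left, inner_sub_right, this])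
    (norm_one_sub_le hT hTn)
  refine ⟨√c • R, hR.smul_of_nonneg (Real.sqrt_nonneg _), ?_⟩
  rw [smul_mul_smul_comm, hRR, Real.mul_self_sqrt hc.le, sub_sub_cancel, smul_smul,
    mul_inv_cancel₀ hc.ne', one_smul]

open Classical in
/-- `Q^{1/2}`: the (unique) positive operator whose square is `Q` (and `0` if `Q` is not positive). -/
def sqrtOp (Q : H →L[ℝ] H) : H →L[ℝ] H :=
  if hQ : Q.IsPositive then (exists_sqrt hQ).choose else 0

theorem sqrtOp_isPositive {Q : H →L[ℝ] H} (hQ : Q.IsPositive) : (sqrtOp Q).IsPositive := by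
  rw [sqrtOp, dif_pos hQ]; exact (exists_sqrt hQ).choose_spec.1

theorem sqrtOp_mul_self {Q : H →L[ℝ] H} (hQ : Q.IsPositive) : sqrtOp Q * sqrtOp Q = Q := by
  rw [sqrtOp, dif_pos hQ]; exact (exists_sqrt hQ).choose_spec.2

/-- `Q^{-1/2}`: the inverse of `Q^{1/2}`, as a map from the range `Q^{1/2}(H)` to `H`. It is
meaningful only on `Q^{1/2}(H)` and when `Q` is injective. -/
def sqrtInv (Q : H →L[ℝ] H) : H → H := Function.invFun (sqrtOp Q)

end SquareRoot

variable {H : Type*} [NormedAddCommGroup H] [InnerProductSpace ℝ H] [CompleteSpace H]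

/-- A strongly continuous semigroup `(S(t))_{t ≥ 0}` of bounded operators; the values of `S` at
negative times play no role. -/
structure IsC0Semigroup (S : ℝ → H →L[ℝ] H) : Prop where
  zero : S 0 = 1
  add : ∀ s t, 0 ≤ s → 0 ≤ t → S (s + t) = S s * S t
  continuousOn : ∀ x, ContinuousOn (fun t => S t x) (Set.Ici 0)

/-- The trace of a positive operator, with values in `[0, ∞]`, computed in an orthonormal basis
(the value does not depend on the basis, see `posTrace_eq`). -/
def posTrace (T : H →L[ℝ] H) : ℝ≥0∞ :=
  ∑' i, ENNReal.ofReal ⟪T ((exists_hilbertBasis ℝ H).choose_spec.choose i),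
    (exists_hilbertBasis ℝ H).choose_spec.choose i⟫_ℝ

theorem ofReal_inner_self {ι : Type*} (d : HilbertBasis ι ℝ H) (x : H) :
    ENNReal.ofReal ⟪x, x⟫_ℝ = ∑' j, ENNReal.ofReal (⟪x, d j⟫_ℝ ^ 2) := by
  have h : HasSum (fun j => ⟪x, d j⟫_ℝ ^ 2) ⟪x, x⟫_ℝ := by
    simpa [sq, real_inner_comm] using d.hasSum_inner_mul_inner x x
  rw [← h.tsum_eq, ENNReal.ofReal_tsum_of_nonneg (fun _ => sq_nonneg _) h.summable]

theorem tsum_trace_eq {ι κ : Type*} (b : HilbertBasis ι ℝ H) (c : HilbertBasis κ ℝ H)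
    {T : H →L[ℝ] H} (hT : T.IsPositive) :
    ∑' i, ENNReal.ofReal ⟪T (b i), b i⟫_ℝ = ∑' i, ENNReal.ofReal ⟪T (c i), c i⟫_ℝ := by
  set R := sqrtOp T
  have hR : ∀ x y, ⟪R x, y⟫_ℝ = ⟪x, R y⟫_ℝ := fun x y =>
    (sqrtOp_isPositive hT).inner_left_eq_inner_right x y
  have hRR : ∀ x, ⟪T x, x⟫_ℝ = ⟪R x, R x⟫_ℝ := fun x => by
    rw [hR, real_inner_comm, ← mul_apply_eq_comp, sqrtOp_mul_self hT]
  simp_rw [hRR]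
  rw [tsum_congr fun i => ofReal_inner_self c (R (b i)),
    tsum_congr fun i => ofReal_inner_self b (R (c i)), ENNReal.tsum_comm]
  refine tsum_congr fun j => tsum_congr fun i => ?_
  rw [hR, real_inner_comm]

theorem posTrace_eq {ι : Type*} (b : HilbertBasis ι ℝ H) {T : H →L[ℝ] H} (hT : T.IsPositive) :
    posTrace T = ∑' i, ENNReal.ofReal ⟪T (b i), b i⟫_ℝ :=
  tsum_trace_eq _ b hT

/-- The operator `Q_∞ x = ∫_0^∞ S(s) Q S*(s) x ds` (strong integral). -/
def covInfty (S : ℝ → H →L[ℝ] H) (Q : H →L[ℝ] H) (x : H) : H :=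
  ∫ s in Set.Ioi (0 : ℝ), S s (Q ((S s).adjoint x))

/-- `μ` is the centered Gaussian measure on `H` with covariance operator `C`. -/
structure IsCenteredGaussian [MeasurableSpace H] [BorelSpace H] (μ : Measure H) (C : H → H) :
    Prop where
  isGaussian : IsGaussian μ
  mean : ∫ x, x ∂μ = 0
  cov : ∀ x, covarianceOperator μ x = C x

section Noise

variable {Ω : Type*} [MeasurableSpace Ω]

/-- A standard cylindrical Wiener process on `H`, given by the real processes
`t ↦ W t h = ⟨W(t), h⟩`: jointly Gaussian and centered, with
`E[⟨W(s), g⟩ ⟨W(t), h⟩] = min(s, t) ⟨g, h⟩`, and with almost surely continuous paths.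
Linearity of `h ↦ W t h` (almost surely) follows from the covariance. -/
structure IsCylindricalWiener (W : ℝ≥0 → H → Ω → ℝ) (P : Measure Ω) : Prop where
  isGaussianProcess : IsGaussianProcess (fun p : ℝ≥0 × H => W p.1 p.2) P
  mean : ∀ t h, ∫ ω, W t h ω ∂P = 0
  cov : ∀ s t g h, cov[W s g, W t h; P] = (min s t : ℝ≥0) * ⟪g, h⟫_ℝ
  continuous : ∀ h, ∀ᵐ ω ∂P, Continuous fun t => W t h ω

variable (H) in
/-- The data of an `H`-valued step function `∑_i 1_{(a_i, b_i]} h_i` on `[0, ∞)`. -/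
structure StepFun where
  n : ℕ
  left : Fin n → ℝ≥0
  right : Fin n → ℝ≥0
  le : ∀ i, left i ≤ right i
  val : Fin n → H

/-- The step function `s ↦ ∑_i 1_{(a_i, b_i]}(s) h_i`. -/
def StepFun.toFun (φ : StepFun H) (s : ℝ) : H :=
  ∑ i, (Set.Ioc (φ.left i : ℝ) (φ.right i)).indicator (fun _ => φ.val i) s

/-- The Wiener integral `∑_i (⟨W(b_i), h_i⟩ - ⟨W(a_i), h_i⟩)` of a step function. -/
def StepFun.integral (φ : StepFun H) (W : ℝ≥0 → H → Ω → ℝ) (ω : Ω) : ℝ :=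
  ∑ i, (W (φ.right i) (φ.val i) ω - W (φ.left i) (φ.val i) ω)

/-- `X = ∫_0^∞ ⟨f(s), dW(s)⟩`: the Wiener integral of the deterministic function `f`, that is the
limit in `L²(P)` of the integrals of step functions converging to `f` in `L²((0, ∞); H)`. -/
def IsWienerIntegral (W : ℝ≥0 → H → Ω → ℝ) (P : Measure Ω) (f : ℝ → H) (X : Ω → ℝ) : Prop :=
  ∃ φ : ℕ → StepFun H,
    Tendsto (fun n => eLpNorm (fun s => (φ n).toFun s - f s) 2 (volume.restrict (Set.Ioi 0)))
      atTop (𝓝 0) ∧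
    Tendsto (fun n => eLpNorm (fun ω => (φ n).integral W ω - X ω) 2 P) atTop (𝓝 0)

/-- `Z(t, x) = S(t) x + ∫_0^t S(t - s) Q^{1/2} dW(s)`, the (mild) solution of
`dZ = A Z dt + Q^{1/2} dW`, `Z(0) = x`, where `A` is the generator of `S`. The `H`-valued
stochastic integral is determined almost surely by its inner products
`⟨∫_0^t S(t - s) Q^{1/2} dW(s), h⟩ = ∫_0^t ⟨Q^{1/2} S(t - s)* h, dW(s)⟩`. -/
structure IsOUProcess [MeasurableSpace H] (S : ℝ → H →L[ℝ] H) (Q : H →L[ℝ] H)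
    (W : ℝ≥0 → H → Ω → ℝ) (P : Measure Ω) (Z : ℝ → H → Ω → H) : Prop where
  aemeasurable : ∀ t, 0 ≤ t → ∀ x, AEMeasurable (Z t x) P
  formula : ∀ t, 0 ≤ t → ∀ x h,
    IsWienerIntegral W P
      ((Set.Ioc 0 t).indicator fun s => sqrtOp Q ((S (t - s)).adjoint h))
      (fun ω => ⟪Z t x ω - S t x, h⟫_ℝ)

/-- The transition semigroup `R_t φ (x) = E φ(Z(t, x))`. -/
def transition (P : Measure Ω) (Z : ℝ → H → Ω → H) (t : ℝ) (φ : H → ℝ) (x : H) : ℝ :=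
  ∫ ω, φ (Z t x ω) ∂P

/-- `T` is the extension of `R_t` from bounded Borel functions to a bounded operator on
`L²(H, μ)` (unique, since bounded Borel functions are dense). -/
def IsL2Extension [MeasurableSpace H] (P : Measure Ω) (Z : ℝ → H → Ω → H) (μ : Measure H) (t : ℝ)
    (T : Lp ℝ 2 μ →L[ℝ] Lp ℝ 2 μ) : Prop :=
  ∀ φ : H → ℝ, Measurable φ → (∃ C, ∀ x, |φ x| ≤ C) →
    ∀ f : Lp ℝ 2 μ, f =ᵐ[μ] φ → T f =ᵐ[μ] transition P Z t φ

/-- The semigroup `(R_t)` is symmetric in `L²(H, μ)`: for every `t ≥ 0`, `R_t` acts as a bounded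
operator on `L²(H, μ)`, and this operator is symmetric. -/
def IsSymmetricInL2 [MeasurableSpace H] (P : Measure Ω) (Z : ℝ → H → Ω → H) (μ : Measure H) :
    Prop :=
  ∀ t, 0 ≤ t → ∃ T : Lp ℝ 2 μ →L[ℝ] Lp ℝ 2 μ,
    IsL2Extension P Z μ t T ∧ (T : Lp ℝ 2 μ →ₗ[ℝ] Lp ℝ 2 μ).IsSymmetric

end Noise

/-- The family of maps `S_Q(t) = Q^{-1/2} S(t) Q^{1/2}`. -/
def SQ (S : ℝ → H →L[ℝ] H) (Q : H →L[ℝ] H) (t : ℝ) (x : H) : H :=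
  sqrtInv Q (S t (sqrtOp Q x))

/-- The family of maps `F(t) : H → H`, `t ≥ 0`, is a `C_0`-semigroup of bounded symmetric
operators that are contractions. -/
def IsSymmContractionSemigroup (F : ℝ → H → H) : Prop :=
  ∃ T : ℝ → H →L[ℝ] H, (∀ t, 0 ≤ t → ∀ x, T t x = F t x) ∧ IsC0Semigroup T ∧
    (∀ t, 0 ≤ t → (T t : H →ₗ[ℝ] H).IsSymmetric) ∧ ∀ t, 0 ≤ t → ‖T t‖ ≤ 1

end OrnsteinUhlenbeck

end

/-!
# Symmetry of the Ornstein–Uhlenbeck semigroup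

The proof passes through the condition that `S(t) Q_∞` is symmetric for every `t ≥ 0`, that is
`S(t) Q_∞ = Q_∞ S(t)*`.

*Probability.* A Wiener integral `∫ ⟨f, dW⟩` is an `L²`-limit of integrals of step functions, so it
is centered Gaussian with variance `∫ ‖f‖²` (`IsWienerIntegral.integral_exp`). By the Lyapunov
identity `∫_0^t S(s) Q S(s)* ds = Q_∞ - S(t) Q_∞ S(t)*`, the variable `Z(t, x)` is Gaussian with mean
`S(t) x` and covariance `Q_∞ - S(t) Q_∞ S(t)*`. If `X` has law `μ` and is independent of the noise,
the pair `(X, Z(t, X))` is therefore centered Gaussian with both marginals `μ` and with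
cross-covariance `S(t) Q_∞`. Since `∫ ψ R_t φ dμ = E[ψ(X) φ(Z(t, X))]`, the operator `R_t` is
symmetric in `L²(μ)` if and only if this pair is exchangeable (`jointLaw_swap`,
`exists_symmetric_operator`), which for a Gaussian pair means that the cross-covariance is symmetric
(`isSymmetricInL2_iff`). The bounded operator on `L²(μ)` is obtained as `J₁* J₂`, where `J₁, J₂`
embed `L²(μ)` into `L²` of the joint law through the two projections.

*Operators.* If all `S(t) Q_∞` are symmetric, differentiating the Lyapunov identity shows that all
`S(t) Q` are symmetric (`semigroup_Q_comm`), so `Q` is injective because `Q_∞` is. Then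
`a(t) = ‖Q^{1/2} S(t)* x‖` satisfies `a((s + t) / 2)² ≤ a(s) a(t)` and `∫ a² < ∞`, and a log-convex
square integrable function is at most `a(0)` (`norm_sqrtOp_adjoint_le`). Hence
`Q^{1/2} x ↦ Q^{1/2} S(t)* x` extends to a symmetric contraction `T(t)`, and
`Q^{1/2} T(t) = S(t) Q^{1/2}` identifies it with `S_Q(t)`. Conversely, symmetry of `S_Q(t)` gives
`S(t) Q = Q^{1/2} S_Q(t) Q^{1/2} = Q S(t)*`, and integrating along the semigroup gives
`S(t) Q_∞ = Q_∞ S(t)*` (`symm_covInfty_iff`).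
-/

namespace OrnsteinUhlenbeck

variable {H : Type*} [NormedAddCommGroup H] [InnerProductSpace ℝ H] [CompleteSpace H]

/-! ### Weak measurability -/

theorem countable_of_hilbertBasis [TopologicalSpace.SeparableSpace H] {ι : Type*}
    (b : HilbertBasis ι ℝ H) : Countable ι := by
  have hd : ∀ i j, i ≠ j → √2 ≤ dist (b i) (b j) := by
    intro i j hij
    rw [dist_eq_norm]
    refine (Real.sqrt_le_left (norm_nonneg _)).2 ?_
    rw [norm_sub_sq_real, b.orthonormal.1 i, b.orthonormal.1 j, b.orthonormal.2 hij]
    norm_num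
  have h := Set.PairwiseDisjoint.countable_of_isOpen (a := (Set.univ : Set ι))
    (s := fun i => Metric.ball (b i) (1 / 2)) (fun i _ j _ hij => by
      refine Metric.ball_disjoint_ball ?_
      have h1 : (1 : ℝ) ≤ √2 := Real.one_le_sqrt.2 one_le_two
      linarith [hd i j hij]) (fun i _ => Metric.isOpen_ball)
    (fun i _ => ⟨b i, Metric.mem_ball_self (by norm_num)⟩)
  exact Set.countable_univ_iff.1 h

/-- Pettis' theorem in a separable Hilbert space: weak measurability implies strong
measurability. -/
theorem aestronglyMeasurable_of_inner [TopologicalSpace.SeparableSpace H] {α : Type*}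
    [MeasurableSpace α] {ν : Measure α} {f : α → H}
    (hf : ∀ y, AEStronglyMeasurable (fun a => ⟪f a, y⟫_ℝ) ν) : AEStronglyMeasurable f ν := by
  obtain ⟨w, b, -⟩ := exists_hilbertBasis ℝ H
  have : Countable w := countable_of_hilbertBasis b
  refine aestronglyMeasurable_of_tendsto_ae (u := (atTop : Filter (Finset w)))
    (f := fun s a => ∑ i ∈ s, ⟪f a, b i⟫_ℝ • b i) (fun s => ?_) (ae_of_all _ fun a => ?_)
  · exact Finset.aestronglyMeasurable_fun_sum s fun i _ => (hf _).smul_const _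
  · have h := b.hasSum_repr (f a)
    have e : (fun i => b.repr (f a) i • b i) = fun i => ⟪f a, b i⟫_ℝ • b i := by
      funext i
      rw [b.repr_apply_apply, real_inner_comm]
    rw [e] at h
    exact h

/-! ### The positive square root and the trace -/

theorem sqrtOp_inner {Q : H →L[ℝ] H} (hQ : Q.IsPositive) (x y : H) :
    ⟪sqrtOp Q x, y⟫_ℝ = ⟪x, sqrtOp Q y⟫_ℝ :=
  (sqrtOp_isPositive hQ).inner_left_eq_inner_right x y

theorem sqrtOp_sqrtOp {Q : H →L[ℝ] H} (hQ : Q.IsPositive) (x : H) :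
    sqrtOp Q (sqrtOp Q x) = Q x := by
  rw [← mul_apply_eq_comp, sqrtOp_mul_self hQ]

theorem inner_sqrtOp_sqrtOp {Q : H →L[ℝ] H} (hQ : Q.IsPositive) (x y : H) :
    ⟪sqrtOp Q x, sqrtOp Q y⟫_ℝ = ⟪Q x, y⟫_ℝ := by
  rw [← sqrtOp_inner hQ, sqrtOp_sqrtOp hQ]

theorem posTrace_eq_tsum_enorm_sq {ι : Type*} (b : HilbertBasis ι ℝ H) {T : H →L[ℝ] H}
    (hT : T.IsPositive) : posTrace T = ∑' i, ‖sqrtOp T (b i)‖ₑ ^ 2 := by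
  rw [posTrace_eq b hT]
  refine tsum_congr fun i => ?_
  rw [← inner_sqrtOp_sqrtOp hT, real_inner_self_eq_norm_sq, ENNReal.ofReal_pow (norm_nonneg _),
    ofReal_norm]

theorem enorm_sqrtOp_sq_le {T : H →L[ℝ] H} (hT : T.IsPositive) (x : H) :
    ‖sqrtOp T x‖ₑ ^ 2 ≤ posTrace T * ‖x‖ₑ ^ 2 := by
  obtain ⟨w, b, -⟩ := exists_hilbertBasis ℝ H
  have h : ‖sqrtOp T x‖ₑ ^ 2 = ENNReal.ofReal ⟪sqrtOp T x, sqrtOp T x⟫_ℝ := by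
    rw [real_inner_self_eq_norm_sq, ENNReal.ofReal_pow (norm_nonneg _), ofReal_norm]
  rw [h, ofReal_inner_self b, posTrace_eq_tsum_enorm_sq b hT, ← ENNReal.tsum_mul_right]
  refine ENNReal.tsum_le_tsum fun i => ?_
  rw [sqrtOp_inner hT, ← ofReal_norm, ← ofReal_norm, ← ENNReal.ofReal_pow (norm_nonneg _),
    ← ENNReal.ofReal_pow (norm_nonneg _), ← ENNReal.ofReal_mul (sq_nonneg _)]
  refine ENNReal.ofReal_le_ofReal ?_
  rw [← mul_pow, sq_le_sq, abs_of_nonneg (by positivity : 0 ≤ ‖sqrtOp T (b i)‖ * ‖x‖), mul_comm]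
  exact abs_real_inner_le_norm _ _

/-- The operator norm of a positive operator is at most its trace. -/
theorem enorm_apply_le_posTrace {T : H →L[ℝ] H} (hT : T.IsPositive) (x : H) :
    ‖T x‖ₑ ≤ posTrace T * ‖x‖ₑ := by
  rw [← sqrtOp_sqrtOp hT]
  refine (ENNReal.pow_le_pow_left_iff two_ne_zero).1 ?_
  calc ‖sqrtOp T (sqrtOp T x)‖ₑ ^ 2 ≤ posTrace T * ‖sqrtOp T x‖ₑ ^ 2 := enorm_sqrtOp_sq_le hT _
    _ ≤ posTrace T * (posTrace T * ‖x‖ₑ ^ 2) := by gcongr; exact enorm_sqrtOp_sq_le hT _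
    _ = _ := by ring

/-! ### The covariance operator -/

theorem adjoint_zero_time {S : ℝ → H →L[ℝ] H} (hS : IsC0Semigroup S) (x : H) :
    (S 0).adjoint x = x := by
  rw [hS.zero]
  exact ext_inner_right ℝ fun v => by rw [ContinuousLinearMap.adjoint_inner_left]; simp

theorem adjoint_add_apply {S : ℝ → H →L[ℝ] H} (hS : IsC0Semigroup S) {s t : ℝ} (hs : 0 ≤ s)
    (ht : 0 ≤ t) (x : H) : (S (s + t)).adjoint x = (S s).adjoint ((S t).adjoint x) := by
  refine ext_inner_right ℝ fun v => ?_
  simp only [ContinuousLinearMap.adjoint_inner_left]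
  rw [add_comm, hS.add t s ht hs, mul_apply_eq_comp]

theorem conj_isPositive {Q : H →L[ℝ] H} (hQ : Q.IsPositive) (T : H →L[ℝ] H) :
    (T * Q * T.adjoint).IsPositive := by
  simpa [ContinuousLinearMap.comp_assoc] using! hQ.conj_adjoint T


section Operators

variable [TopologicalSpace.SeparableSpace H]

/-- The adjoint semigroup is weakly continuous, hence strongly measurable. -/
theorem aestronglyMeasurable_adjoint {S : ℝ → H →L[ℝ] H} (hS : IsC0Semigroup S) (x : H) :
    AEStronglyMeasurable (fun s => (S s).adjoint x) (volume.restrict (Set.Ioi (0 : ℝ))) := by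
  refine aestronglyMeasurable_of_inner fun y => ?_
  simp_rw [ContinuousLinearMap.adjoint_inner_left]
  refine ContinuousOn.aestronglyMeasurable ?_ measurableSet_Ioi
  exact continuousOn_const.inner ((hS.continuousOn y).mono Set.Ioi_subset_Ici_self)

/-- The integrand defining `Q_∞ x` is Bochner integrable, being dominated by `tr(S(s) Q S(s)*) ‖x‖`;
so `covInfty` is a genuine integral. -/
theorem integrableOn_conj {S : ℝ → H →L[ℝ] H} (hS : IsC0Semigroup S) {Q : H →L[ℝ] H}
    (hQ : Q.IsPositive)
    (htrace : ∫⁻ s in Set.Ioi (0 : ℝ), posTrace (S s * Q * (S s).adjoint) < ∞) (x : H) :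
    IntegrableOn (fun s => S s (Q ((S s).adjoint x))) (Set.Ioi (0 : ℝ)) := by
  refine ⟨aestronglyMeasurable_of_inner fun y => ?_, ?_⟩
  · have e : (fun s => ⟪S s (Q ((S s).adjoint x)), y⟫_ℝ) =
        fun s => ⟪Q ((S s).adjoint x), (S s).adjoint y⟫_ℝ := by
      funext s
      rw [ContinuousLinearMap.adjoint_inner_right]
    rw [e]
    exact (Q.continuous.comp_aestronglyMeasurable (aestronglyMeasurable_adjoint hS x)).inner
      (aestronglyMeasurable_adjoint hS y)
  · calc ∫⁻ s in Set.Ioi (0 : ℝ), ‖S s (Q ((S s).adjoint x))‖ₑ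
        ≤ ∫⁻ s in Set.Ioi (0 : ℝ), posTrace (S s * Q * (S s).adjoint) * ‖x‖ₑ :=
          lintegral_mono fun s => enorm_apply_le_posTrace (conj_isPositive hQ (S s)) x
      _ = (∫⁻ s in Set.Ioi (0 : ℝ), posTrace (S s * Q * (S s).adjoint)) * ‖x‖ₑ :=
          lintegral_mul_const' _ _ enorm_ne_top
      _ < ∞ := ENNReal.mul_lt_top htrace enorm_lt_top

theorem inner_covInfty {S : ℝ → H →L[ℝ] H} (hS : IsC0Semigroup S) {Q : H →L[ℝ] H}
    (hQ : Q.IsPositive)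
    (htrace : ∫⁻ s in Set.Ioi (0 : ℝ), posTrace (S s * Q * (S s).adjoint) < ∞) (x y : H) :
    ⟪covInfty S Q x, y⟫_ℝ =
      ∫ s in Set.Ioi (0 : ℝ), ⟪Q ((S s).adjoint x), (S s).adjoint y⟫_ℝ := by
  rw [covInfty, real_inner_comm, ← integral_inner (integrableOn_conj hS hQ htrace x) y]
  refine integral_congr_ae (ae_of_all _ fun s => ?_)
  simp only
  rw [real_inner_comm, ContinuousLinearMap.adjoint_inner_right]

theorem integrableOn_inner_conj {S : ℝ → H →L[ℝ] H} (hS : IsC0Semigroup S) {Q : H →L[ℝ] H}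
    (hQ : Q.IsPositive)
    (htrace : ∫⁻ s in Set.Ioi (0 : ℝ), posTrace (S s * Q * (S s).adjoint) < ∞) (x y : H) :
    IntegrableOn (fun s => ⟪Q ((S s).adjoint x), (S s).adjoint y⟫_ℝ) (Set.Ioi (0 : ℝ)) := by
  refine ((integrableOn_conj hS hQ htrace x).inner_const y).congr (ae_of_all _ fun s => ?_)
  simp only
  rw [ContinuousLinearMap.adjoint_inner_right]

theorem inner_covInfty_comm {S : ℝ → H →L[ℝ] H} (hS : IsC0Semigroup S) {Q : H →L[ℝ] H}
    (hQ : Q.IsPositive)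
    (htrace : ∫⁻ s in Set.Ioi (0 : ℝ), posTrace (S s * Q * (S s).adjoint) < ∞) (x y : H) :
    ⟪covInfty S Q x, y⟫_ℝ = ⟪covInfty S Q y, x⟫_ℝ := by
  rw [inner_covInfty hS hQ htrace, inner_covInfty hS hQ htrace]
  refine integral_congr_ae (ae_of_all _ fun s => ?_)
  simp only
  rw [hQ.inner_left_eq_inner_right, real_inner_comm]

theorem integral_Ioi_comp_add {E : Type*} [NormedAddCommGroup E] [NormedSpace ℝ E] (f : ℝ → E)
    (a t : ℝ) : ∫ s in Set.Ioi a, f (s + t) = ∫ s in Set.Ioi (a + t), f s := by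
  have h := (measurePreserving_add_right (volume : Measure ℝ) t).setIntegral_preimage_emb
    (MeasurableEquiv.addRight t).measurableEmbedding f (Set.Ioi (a + t))
  simpa using h

/-- The Lyapunov identity `Q_t = Q_∞ - S(t) Q_∞ S(t)*`, where `Q_t = ∫_0^t S(s) Q S(s)* ds`. -/
theorem integral_Ioc_inner_conj {S : ℝ → H →L[ℝ] H} (hS : IsC0Semigroup S) {Q : H →L[ℝ] H}
    (hQ : Q.IsPositive)
    (htrace : ∫⁻ s in Set.Ioi (0 : ℝ), posTrace (S s * Q * (S s).adjoint) < ∞) {t : ℝ}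
    (ht : 0 ≤ t) (x y : H) :
    ∫ s in Set.Ioc 0 t, ⟪Q ((S s).adjoint x), (S s).adjoint y⟫_ℝ =
      ⟪covInfty S Q x, y⟫_ℝ - ⟪covInfty S Q ((S t).adjoint x), (S t).adjoint y⟫_ℝ := by
  have hi := integrableOn_inner_conj hS hQ htrace x y
  have h1 : ⟪covInfty S Q ((S t).adjoint x), (S t).adjoint y⟫_ℝ =
      ∫ s in Set.Ioi t, ⟪Q ((S s).adjoint x), (S s).adjoint y⟫_ℝ := by
    rw [inner_covInfty hS hQ htrace]
    have h2 := integral_Ioi_comp_add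
      (fun s => ⟪Q ((S s).adjoint x), (S s).adjoint y⟫_ℝ) 0 t
    rw [zero_add] at h2
    rw [← h2]
    refine setIntegral_congr_fun measurableSet_Ioi fun s hs => ?_
    rw [adjoint_add_apply hS (le_of_lt hs) ht, adjoint_add_apply hS (le_of_lt hs) ht]
  rw [h1, inner_covInfty hS hQ htrace, ← Set.Ioc_union_Ioi_eq_Ioi ht,
    setIntegral_union (Set.Ioc_disjoint_Ioi le_rfl) measurableSet_Ioi
      (hi.mono_set Set.Ioc_subset_Ioi_self) (hi.mono_set (Set.Ioi_subset_Ioi ht))]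
  ring

/-! ### The intertwining relation `S(r) Q = Q S(r)*` -/

theorem eq_zero_of_inner_semigroup {S : ℝ → H →L[ℝ] H} (hS : IsC0Semigroup S) {x w : H}
    (h : ∀ s, 0 < s → ⟪x, S s w⟫_ℝ = 0) : ⟪x, w⟫_ℝ = 0 := by
  have hc : ContinuousWithinAt (fun s => ⟪x, S s w⟫_ℝ) (Set.Ici 0) 0 :=
    continuousWithinAt_const.inner (hS.continuousOn w 0 Set.self_mem_Ici)
  have h1 : Tendsto (fun s => ⟪x, S s w⟫_ℝ) (𝓝[>] 0) (𝓝 ⟪x, w⟫_ℝ) := by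
    have := hc.tendsto
    rw [hS.zero] at this
    exact this.mono_left (nhdsWithin_mono _ Set.Ioi_subset_Ici_self)
  have h2 : Tendsto (fun s => ⟪x, S s w⟫_ℝ) (𝓝[>] 0) (𝓝 0) :=
    tendsto_const_nhds.congr' (eventually_nhdsWithin_of_forall fun s hs => (h s hs).symm)
  exact tendsto_nhds_unique h1 h2

/-- An integrable function on `(0, 1]` whose primitive vanishes is zero almost everywhere. -/
theorem ae_eq_zero_of_integral_Ioc {k : ℝ → ℝ} (hk : IntegrableOn k (Set.Ioc 0 1))
    (h : ∀ t ∈ Set.Icc (0 : ℝ) 1, ∫ s in Set.Ioc 0 t, k s = 0) :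
    ∀ᵐ s, s ∈ Set.Ioo (0 : ℝ) 1 → k s = 0 := by
  have hi : IntervalIntegrable k volume 0 1 :=
    (intervalIntegrable_iff_integrableOn_Ioc_of_le zero_le_one).2 hk
  filter_upwards [hi.ae_hasDerivAt_integral] with s hs hs01
  have h1 := hs (by rw [Set.uIcc_of_le zero_le_one]; exact Set.Ioo_subset_Icc_self hs01) 0
    (by rw [Set.uIcc_of_le zero_le_one]; exact ⟨le_rfl, zero_le_one⟩)
  have h2 : HasDerivAt (fun t => ∫ u in (0 : ℝ)..t, k u) 0 s := by
    refine (hasDerivAt_const s (0 : ℝ)).congr_of_eventuallyEq ?_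
    filter_upwards [isOpen_Ioo.mem_nhds hs01] with t ht
    rw [intervalIntegral.integral_of_le ht.1.le, h t (Set.Ioo_subset_Icc_self ht)]
  exact h1.unique h2

/-- If `S(t) Q_∞` is symmetric for all `t ≥ 0`, then so is `S(r) Q` for all `r ≥ 0`. The adjoint
semigroup is only used through its weak continuity. -/
theorem semigroup_Q_comm {S : ℝ → H →L[ℝ] H} (hS : IsC0Semigroup S) {Q : H →L[ℝ] H}
    (hQ : Q.IsPositive)
    (htrace : ∫⁻ s in Set.Ioi (0 : ℝ), posTrace (S s * Q * (S s).adjoint) < ∞)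
    (hsymm : ∀ t, 0 ≤ t → ∀ x y,
      ⟪covInfty S Q x, (S t).adjoint y⟫_ℝ = ⟪covInfty S Q y, (S t).adjoint x⟫_ℝ)
    {r : ℝ} (hr : 0 ≤ r) (x : H) : S r (Q x) = Q ((S r).adjoint x) := by
  set d : H → H → ℝ := fun x y => ⟪Q x, (S r).adjoint y⟫_ℝ - ⟪Q y, (S r).adjoint x⟫_ℝ with hd
  have hanti : ∀ x y, d x y = - d y x := fun x y => by simp [hd]
  have hdw : ∀ x z, d x z = ⟪x, Q ((S r).adjoint z) - S r (Q z)⟫_ℝ := fun x z => by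
    simp only [hd]
    rw [inner_sub_right, hQ.inner_left_eq_inner_right, ContinuousLinearMap.adjoint_inner_right,
      real_inner_comm x (S r (Q z))]
  have hcomm : ∀ s, 0 ≤ s → ∀ y, (S r).adjoint ((S s).adjoint y) =
      (S s).adjoint ((S r).adjoint y) := fun s hs y => by
    rw [← adjoint_add_apply hS hr hs, ← adjoint_add_apply hS hs hr, add_comm]
  have hint : ∀ x y, IntegrableOn
      (fun s => ⟪Q ((S s).adjoint x), (S s).adjoint ((S r).adjoint y)⟫_ℝ) (Set.Ioi 0) :=
    fun x y => integrableOn_inner_conj hS hQ htrace _ _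
  have hdint : ∀ x y, IntegrableOn (fun s => d ((S s).adjoint x) ((S s).adjoint y))
      (Set.Ioi 0) := fun x y => by
    refine ((hint x y).sub (hint y x)).congr_fun (fun s hs => ?_) measurableSet_Ioi
    simp only [hd, Pi.sub_apply]
    rw [hcomm s (le_of_lt hs), hcomm s (le_of_lt hs)]
  have hd0 : ∀ x y t, 0 ≤ t →
      ∫ s in Set.Ioc 0 t, d ((S s).adjoint x) ((S s).adjoint y) = 0 := fun x y t ht => by
    have e : ∫ s in Set.Ioc 0 t, d ((S s).adjoint x) ((S s).adjoint y) =
        ∫ s in Set.Ioc 0 t, (⟪Q ((S s).adjoint x), (S s).adjoint ((S r).adjoint y)⟫_ℝ -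
          ⟪Q ((S s).adjoint y), (S s).adjoint ((S r).adjoint x)⟫_ℝ) := by
      refine setIntegral_congr_fun measurableSet_Ioc fun s hs => ?_
      simp only [hd]
      rw [hcomm s hs.1.le, hcomm s hs.1.le]
    rw [e, integral_sub ((hint x y).mono_set Set.Ioc_subset_Ioi_self)
      ((hint y x).mono_set Set.Ioc_subset_Ioi_self), integral_Ioc_inner_conj hS hQ htrace ht,
      integral_Ioc_inner_conj hS hQ htrace ht, hsymm r hr x y, ← hcomm t ht, ← hcomm t ht,
      hsymm r hr ((S t).adjoint x)]
    ring
  -- a single null set of times serves all `x, y`: take a dense sequence, then use continuity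
  have hae : ∀ᵐ s, s ∈ Set.Ioo (0 : ℝ) 1 → ∀ x y, d ((S s).adjoint x) ((S s).adjoint y) = 0 := by
    have h1 : ∀ᵐ s, ∀ i j : ℕ, s ∈ Set.Ioo (0 : ℝ) 1 →
        d ((S s).adjoint (TopologicalSpace.denseSeq H i))
          ((S s).adjoint (TopologicalSpace.denseSeq H j)) = 0 :=
      ae_all_iff.2 fun i => ae_all_iff.2 fun j => ae_eq_zero_of_integral_Ioc
        ((hdint _ _).mono_set Set.Ioc_subset_Ioi_self) fun t ht => hd0 _ _ t ht.1
    filter_upwards [h1] with s hs hs01 x y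
    have hcx : ∀ y, Continuous fun x => d ((S s).adjoint x) ((S s).adjoint y) := fun y => by
      simp only [hd]; fun_prop
    have hcy : ∀ x, Continuous fun y => d ((S s).adjoint x) ((S s).adjoint y) := fun x => by
      simp only [hd]; fun_prop
    have h2 : ∀ x j, d ((S s).adjoint x) ((S s).adjoint (TopologicalSpace.denseSeq H j)) = 0 :=
      fun x j => congrFun ((TopologicalSpace.denseRange_denseSeq H).equalizer (hcx _)
        continuous_const (funext fun i => hs i j hs01)) x
    exact congrFun ((TopologicalSpace.denseRange_denseSeq H).equalizer (hcy x)
        continuous_const (funext fun j => h2 x j)) y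
  -- `d` also vanishes on the ranges of `S(s)*` and `S(s')*` for distinct `s, s' > 0`; this allows
  -- `s → 0` and `s' → 0` one after the other, so that the weak continuity of `S*` is enough
  have hpos : ∀ s s', 0 < s → 0 < s' → ∀ x y, d ((S s).adjoint x) ((S s').adjoint y) = 0 := by
    intro s s' hs hs' x y
    have hε : 0 < min 1 (min s s') := by positivity
    -- the good times have full measure, hence accumulate at `0`
    obtain ⟨u, hu, hgood⟩ : ∃ u ∈ Set.Ioo 0 (min 1 (min s s')),
        (u ∈ Set.Ioo (0 : ℝ) 1 → ∀ x y, d ((S u).adjoint x) ((S u).adjoint y) = 0) := by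
      by_contra! hcon
      have h0 : volume (Set.Ioo 0 (min 1 (min s s'))) = 0 :=
        measure_mono_null (fun u hu => by
          simp only [Set.mem_compl_iff, Set.mem_ofPred_eq]
          intro hgood
          obtain ⟨h1, x, y, h2⟩ := hcon u hu
          exact h2 (hgood h1 x y)) hae
      rw [Real.volume_Ioo, ENNReal.ofReal_eq_zero] at h0
      linarith
    have hu1 := lt_min_iff.1 hu.2
    have hu2 := lt_min_iff.1 hu1.2
    have e1 : ∀ v, u < v → ∀ z, (S v).adjoint z = (S u).adjoint ((S (v - u)).adjoint z) :=
      fun v hv z => by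
        rw [← adjoint_add_apply hS hu.1.le (sub_nonneg.2 hv.le), add_sub_cancel]
    rw [e1 s hu2.1, e1 s' hu2.2]
    exact hgood ⟨hu.1, hu1.1⟩ _ _
  have hzero : ∀ z, (∀ s, 0 < s → ∀ x, d ((S s).adjoint x) z = 0) → ∀ x, d x z = 0 := by
    intro z h x
    rw [hdw]
    refine eq_zero_of_inner_semigroup hS fun s hs => ?_
    rw [← ContinuousLinearMap.adjoint_inner_left, ← hdw]
    exact h s hs x
  have h1 : ∀ s', 0 < s' → ∀ x y, d x ((S s').adjoint y) = 0 := fun s' hs' x y =>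
    hzero _ (fun s hs x => hpos s s' hs hs' x y) x
  have h2 : ∀ x y, d x y = 0 := fun x y =>
    hzero y (fun s hs x => by rw [hanti, h1 s hs, neg_zero]) x
  have h3 : Q ((S r).adjoint x) - S r (Q x) = 0 :=
    ext_inner_left ℝ fun v => by rw [← hdw, h2, inner_zero_right]
  exact (sub_eq_zero.1 h3).symm

/-- If every `S(r) Q`, `r ≥ 0`, is symmetric, then every `S(t) Q_∞` is symmetric. -/
theorem inner_covInfty_adjoint_comm {S : ℝ → H →L[ℝ] H} (hS : IsC0Semigroup S) {Q : H →L[ℝ] H}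
    (hQ : Q.IsPositive)
    (htrace : ∫⁻ s in Set.Ioi (0 : ℝ), posTrace (S s * Q * (S s).adjoint) < ∞)
    (hQS : ∀ r, 0 ≤ r → ∀ x, S r (Q x) = Q ((S r).adjoint x)) {t : ℝ} (ht : 0 ≤ t) (x y : H) :
    ⟪covInfty S Q x, (S t).adjoint y⟫_ℝ = ⟪covInfty S Q y, (S t).adjoint x⟫_ℝ := by
  rw [inner_covInfty hS hQ htrace, inner_covInfty hS hQ htrace]
  refine setIntegral_congr_fun measurableSet_Ioi fun s hs => ?_
  have hs : 0 ≤ s := le_of_lt hs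
  have e : (S s).adjoint ((S t).adjoint y) = (S t).adjoint ((S s).adjoint y) := by
    rw [← adjoint_add_apply hS hs ht, ← adjoint_add_apply hS ht hs, add_comm]
  have e' : (S s).adjoint ((S t).adjoint x) = (S t).adjoint ((S s).adjoint x) := by
    rw [← adjoint_add_apply hS hs ht, ← adjoint_add_apply hS ht hs, add_comm]
  rw [e, e', ContinuousLinearMap.adjoint_inner_right, hQS t ht, hQ.inner_left_eq_inner_right,
    real_inner_comm]

/-! ### The contraction estimate -/

theorem inner_Q_adjoint_adjoint {S : ℝ → H →L[ℝ] H} (hS : IsC0Semigroup S) {Q : H →L[ℝ] H}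
    (hQS : ∀ r, 0 ≤ r → ∀ x, S r (Q x) = Q ((S r).adjoint x)) {p q : ℝ} (hp : 0 ≤ p)
    (hq : 0 ≤ q) (x : H) :
    ⟪Q ((S p).adjoint x), (S q).adjoint x⟫_ℝ = ⟪S (p + q) (Q x), x⟫_ℝ := by
  rw [ContinuousLinearMap.adjoint_inner_right, ← hQS p hp, ← mul_apply_eq_comp, ← hS.add q p hq hp,
    add_comm]

/-- The contraction estimate. The function `a(t) = ‖Q^{1/2} S(t)* x‖` is midpoint log-convex and
square integrable on `(0, ∞)`, hence bounded along `2 ^ n t`; if `a(t) > a(0)`, then log-convexity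
makes `a(2 ^ n t)` grow without bound. -/
theorem norm_sqrtOp_adjoint_le {S : ℝ → H →L[ℝ] H} (hS : IsC0Semigroup S) {Q : H →L[ℝ] H}
    (hQ : Q.IsPositive)
    (htrace : ∫⁻ s in Set.Ioi (0 : ℝ), posTrace (S s * Q * (S s).adjoint) < ∞)
    (hQS : ∀ r, 0 ≤ r → ∀ x, S r (Q x) = Q ((S r).adjoint x)) {t : ℝ} (ht : 0 ≤ t) (x : H) :
    ‖sqrtOp Q ((S t).adjoint x)‖ ≤ ‖sqrtOp Q x‖ := by
  rcases ht.eq_or_lt with rfl | htpos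
  · rw [adjoint_zero_time hS]
  set a : ℝ → ℝ := fun t => ‖sqrtOp Q ((S t).adjoint x)‖ with ha
  have hga : ∀ p q, 0 ≤ p → 0 ≤ q → ⟪S (p + q) (Q x), x⟫_ℝ ≤ a p * a q := fun p q hp hq => by
    rw [← inner_Q_adjoint_adjoint hS hQS hp hq, ← inner_sqrtOp_sqrtOp hQ]
    exact real_inner_le_norm _ _
  have hsq : ∀ p, 0 ≤ p → a p ^ 2 = ⟪S (p + p) (Q x), x⟫_ℝ := fun p hp => by
    rw [← inner_Q_adjoint_adjoint hS hQS hp hp, ← inner_sqrtOp_sqrtOp hQ,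
      real_inner_self_eq_norm_sq]
  have hmid : ∀ p q, 0 ≤ p → 0 ≤ q → a ((p + q) / 2) ^ 2 ≤ a p * a q := fun p q hp hq => by
    rw [hsq _ (by positivity), add_halves]
    exact hga p q hp hq
  have hint : IntegrableOn (fun s => a s ^ 2) (Set.Ioi 0) := by
    refine (integrableOn_inner_conj hS hQ htrace x x).congr (ae_of_all _ fun s => ?_)
    simp only [ha]
    rw [← inner_sqrtOp_sqrtOp hQ, real_inner_self_eq_norm_sq]
  set I := ∫ s in Set.Ioi (0 : ℝ), a s ^ 2 with hI
  -- average `a(t)² ≤ a(t - s) a(t + s) ≤ (a(t - s)² + a(t + s)²) / 2` over `s ∈ (0, t)`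
  have hbound : ∀ t, 0 < t → 2 * t * a t ^ 2 ≤ I := by
    intro t ht
    have hii : ∀ u v, 0 ≤ u → u ≤ v → IntervalIntegrable (fun s => a s ^ 2) volume u v :=
      fun u v hu huv => (intervalIntegrable_iff_integrableOn_Ioc_of_le huv).2
        (hint.mono_set fun s hs => lt_of_le_of_lt hu hs.1)
    have h1 : ∫ s in (0 : ℝ)..t, a (t - s) ^ 2 = ∫ s in (0 : ℝ)..t, a s ^ 2 := by
      rw [intervalIntegral.integral_comp_sub_left (fun s => a s ^ 2)]; simp
    have h2 : ∫ s in (0 : ℝ)..t, a (t + s) ^ 2 = ∫ s in t..(t + t), a s ^ 2 := by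
      rw [intervalIntegral.integral_comp_add_left (fun s => a s ^ 2)]; simp
    have i1 : IntervalIntegrable (fun s => a (t - s) ^ 2) volume 0 t := by
      have := (hii 0 t le_rfl ht.le).comp_sub_left t
      simpa using this.symm
    have i2 : IntervalIntegrable (fun s => a (t + s) ^ 2) volume 0 t := by
      have := (hii t (t + t) ht.le (by linarith)).comp_add_left t
      simpa using this
    calc 2 * t * a t ^ 2 = ∫ _s in (0 : ℝ)..t, 2 * a t ^ 2 := by
          rw [intervalIntegral.integral_const]; simp only [sub_zero, smul_eq_mul]; ring
      _ ≤ ∫ s in (0 : ℝ)..t, (a (t - s) ^ 2 + a (t + s) ^ 2) := by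
          refine intervalIntegral.integral_mono_on ht.le intervalIntegrable_const (i1.add i2)
            fun s hs => ?_
          have := hmid (t - s) (t + s) (by linarith [hs.2]) (by linarith [hs.1])
          rw [show (t - s + (t + s)) / 2 = t by ring] at this
          nlinarith [sq_nonneg (a (t - s) - a (t + s))]
      _ = ∫ s in (0 : ℝ)..(t + t), a s ^ 2 := by
          rw [intervalIntegral.integral_add i1 i2, h1, h2,
            intervalIntegral.integral_add_adjacent_intervals (hii 0 t le_rfl ht.le)
              (hii t (t + t) ht.le (by linarith))]
      _ ≤ I := by
          rw [intervalIntegral.integral_of_le (by linarith)]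
          exact setIntegral_mono_set hint (ae_of_all _ fun s => sq_nonneg _)
            Set.Ioc_subset_Ioi_self.eventuallyLE
  have ha0 : a 0 = ‖sqrtOp Q x‖ := by simp only [ha]; rw [adjoint_zero_time hS]
  rw [← ha0]
  change a t ≤ a 0
  by_contra! hlt
  have hnn : ∀ s, 0 ≤ a s := fun s => norm_nonneg _
  have hdouble : ∀ s, 0 ≤ s → a s ^ 2 ≤ a 0 * a (2 * s) := fun s hs => by
    have := hmid 0 (2 * s) le_rfl (by positivity)
    rwa [show (0 + 2 * s) / 2 = s by ring] at this
  have hpos0 : 0 < a 0 := by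
    rcases (hnn 0).eq_or_lt with h | h
    · have := hdouble t ht
      rw [← h, zero_mul] at this
      nlinarith
    · exact h
  set ρ := a t / a 0 with hρ
  have hρ1 : 1 < ρ := (one_lt_div hpos0).2 hlt
  have hgrow : ∀ n : ℕ, a 0 * ρ ^ (2 ^ n) ≤ a (2 ^ n * t) := by
    intro n
    induction n with
    | zero => simp [hρ, mul_div_cancel₀ _ hpos0.ne']
    | succ n ih =>
      have h1 := hdouble (2 ^ n * t) (by positivity)
      have h2 : (a 0 * ρ ^ (2 ^ n)) ^ 2 ≤ a (2 ^ n * t) ^ 2 :=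
        pow_le_pow_left₀ (by positivity) ih 2
      have h3 : a 0 * (a 0 * ρ ^ (2 ^ (n + 1))) ≤ a 0 * a (2 ^ (n + 1) * t) := by
        calc a 0 * (a 0 * ρ ^ (2 ^ (n + 1))) = (a 0 * ρ ^ (2 ^ n)) ^ 2 := by
              rw [pow_succ 2 n, pow_mul]; ring
          _ ≤ _ := h2.trans (h1.trans_eq (by congr 2; ring))
      exact le_of_mul_le_mul_left h3 hpos0
  have hlin : ∀ n : ℕ, 2 * (2 ^ n * t) * a 0 ^ 2 ≤ I := fun n => by
    refine le_trans ?_ (hbound (2 ^ n * t) (by positivity))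
    have h1 : a 0 ≤ a (2 ^ n * t) :=
      le_trans (le_mul_of_one_le_right hpos0.le (one_le_pow₀ hρ1.le)) (hgrow n)
    gcongr
  obtain ⟨n, hn⟩ := pow_unbounded_of_one_lt (I / (2 * t * a 0 ^ 2)) (one_lt_two (α := ℝ))
  rw [div_lt_iff₀ (by positivity)] at hn
  have := hlin n
  nlinarith

/-! ### The semigroup `S_Q` -/

theorem sqrtOp_injective {Q : H →L[ℝ] H} (hQ : Q.IsPositive) (hinj : Function.Injective Q) :
    Function.Injective (sqrtOp Q) := fun x y h => by
  apply hinj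
  rw [← sqrtOp_sqrtOp hQ, ← sqrtOp_sqrtOp hQ, h]

theorem sqrtOp_denseRange {Q : H →L[ℝ] H} (hQ : Q.IsPositive) (hinj : Function.Injective Q) :
    DenseRange (sqrtOp Q) := by
  have h : (LinearMap.range (sqrtOp Q : H →ₗ[ℝ] H)).topologicalClosure = ⊤ := by
    rw [Submodule.topologicalClosure_eq_top_iff, Submodule.eq_bot_iff]
    intro x hx
    have h1 : sqrtOp Q x = 0 := ext_inner_left ℝ fun v => by
      rw [inner_zero_right, ← sqrtOp_inner hQ]
      exact (Submodule.mem_orthogonal _ _).1 hx _ ⟨v, rfl⟩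
    exact sqrtOp_injective hQ hinj (by rw [h1, map_zero])
  have h2 := Submodule.dense_iff_topologicalClosure_eq_top.2 h
  rw [LinearMap.coe_range] at h2
  exact h2

theorem sqrtInv_sqrtOp {Q : H →L[ℝ] H} (hQ : Q.IsPositive) (hinj : Function.Injective Q) (x : H) :
    sqrtInv Q (sqrtOp Q x) = x :=
  Function.leftInverse_invFun (sqrtOp_injective hQ hinj) x

/-- `ker Q ⊆ ker Q_∞`, because `Q S(s)* x = S(s) Q x`. -/
theorem injective_of_comm {S : ℝ → H →L[ℝ] H} {Q : H →L[ℝ] H}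
    (hQS : ∀ r, 0 ≤ r → ∀ x, S r (Q x) = Q ((S r).adjoint x))
    (hinj : Function.Injective (covInfty S Q)) : Function.Injective Q := by
  refine (injective_iff_map_eq_zero Q).2 fun x hx => hinj ?_
  unfold covInfty
  refine setIntegral_congr_fun measurableSet_Ioi fun s hs => ?_
  rw [← hQS s (le_of_lt hs), hx, map_zero, map_zero, map_zero, map_zero, map_zero]

/-- The operators `S_Q(t)`, constructed as the continuous extensions of
`Q^{1/2} x ↦ Q^{1/2} S(t)* x` from the dense range of `Q^{1/2}`. -/
theorem exists_symmContraction {S : ℝ → H →L[ℝ] H} (hS : IsC0Semigroup S) {Q : H →L[ℝ] H}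
    (hQ : Q.IsPositive)
    (htrace : ∫⁻ s in Set.Ioi (0 : ℝ), posTrace (S s * Q * (S s).adjoint) < ∞)
    (hQS : ∀ r, 0 ≤ r → ∀ x, S r (Q x) = Q ((S r).adjoint x)) (hinj : Function.Injective Q) :
    ∃ T : ℝ → H →L[ℝ] H, (∀ t, 0 ≤ t → ∀ x, sqrtOp Q (T t x) = S t (sqrtOp Q x)) ∧
      IsC0Semigroup T ∧ (∀ t, 0 ≤ t → (T t : H →ₗ[ℝ] H).IsSymmetric) ∧
      ∀ t, 0 ≤ t → ‖T t‖ ≤ 1 := by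
  set R := sqrtOp Q with hR
  have hdense : DenseRange R := sqrtOp_denseRange hQ hinj
  set T : ℝ → H →L[ℝ] H := fun t =>
    ((R ∘L (S t).adjoint : H →L[ℝ] H) : H →ₗ[ℝ] H).extendOfNorm (R : H →ₗ[ℝ] H) with hT
  have hbd : ∀ t, 0 ≤ t → ∀ x, ‖((R ∘L (S t).adjoint : H →L[ℝ] H) : H →ₗ[ℝ] H) x‖ ≤
      1 * ‖(R : H →ₗ[ℝ] H) x‖ := fun t ht x => by
    rw [one_mul]; exact norm_sqrtOp_adjoint_le hS hQ htrace hQS ht x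
  have hTR : ∀ t, 0 ≤ t → ∀ x, T t (R x) = R ((S t).adjoint x) := fun t ht x =>
    LinearMap.extendOfNorm_eq (f := ((R ∘L (S t).adjoint : H →L[ℝ] H) : H →ₗ[ℝ] H))
      (e := (R : H →ₗ[ℝ] H)) hdense ⟨1, hbd t ht⟩ x
  have hTn : ∀ t, 0 ≤ t → ∀ x, ‖T t x‖ ≤ ‖x‖ := fun t ht x =>
    (LinearMap.norm_extendOfNorm_apply_le
      (f := ((R ∘L (S t).adjoint : H →L[ℝ] H) : H →ₗ[ℝ] H))
      (e := (R : H →ₗ[ℝ] H)) hdense 1 (hbd t ht) x).trans_eq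
      (one_mul _)
  have hext : ∀ {F G : H →L[ℝ] H}, (∀ x, F (R x) = G (R x)) → F = G := fun {F G} h =>
    DFunLike.coe_injective (hdense.equalizer F.continuous G.continuous (funext h))
  have hRR : ∀ x, R (R x) = Q x := sqrtOp_sqrtOp hQ
  refine ⟨T, fun t ht x => ?_, ⟨?_, fun s t hs ht => ?_, fun z => ?_⟩, fun t ht => ?_,
    fun t ht => ContinuousLinearMap.opNorm_le_bound _ zero_le_one fun x => by
      rw [one_mul]; exact hTn t ht x⟩
  · have : R ∘L T t = S t ∘L R := hext fun x => by
      simp only [ContinuousLinearMap.comp_apply]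
      rw [hTR t ht, hRR, hRR, hQS t ht]
    exact DFunLike.congr_fun this x
  · exact hext fun x => by rw [hTR 0 le_rfl, adjoint_zero_time hS]; rfl
  · refine hext fun x => ?_
    rw [mul_apply_eq_comp, hTR _ (add_nonneg hs ht), hTR t ht, hTR s hs, adjoint_add_apply hS hs ht]
  -- contractions that are strongly continuous on a dense set are strongly continuous
  · refine continuousOn_of_uniform_approx_of_continuousOn fun u hu => ?_
    obtain ⟨ε, hε, hεu⟩ := Metric.mem_uniformity_dist.1 hu
    obtain ⟨x, hx⟩ := hdense.exists_dist_lt z hε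
    refine ⟨fun t => T t (R x), fun s hs => ?_, fun t ht => hεu ?_⟩
    · have hg : ContinuousOn (fun t => ⟪S t (Q x), x⟫_ℝ) (Set.Ici 0) :=
        (hS.continuousOn (Q x)).inner continuousOn_const
      have hd : ∀ t ∈ Set.Ici (0 : ℝ), ‖T t (R x) - T s (R x)‖ ^ 2 =
          ⟪S (t + t) (Q x), x⟫_ℝ - 2 * ⟪S (t + s) (Q x), x⟫_ℝ + ⟪S (s + s) (Q x), x⟫_ℝ := by
        intro t ht
        rw [hTR t ht, hTR s hs, norm_sub_sq_real, ← real_inner_self_eq_norm_sq,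
          ← real_inner_self_eq_norm_sq, inner_sqrtOp_sqrtOp hQ, inner_sqrtOp_sqrtOp hQ,
          inner_sqrtOp_sqrtOp hQ, inner_Q_adjoint_adjoint hS hQS ht ht,
          inner_Q_adjoint_adjoint hS hQS ht hs, inner_Q_adjoint_adjoint hS hQS hs hs]
      have hg1 : ContinuousOn (fun t => ⟪S (t + t) (Q x), x⟫_ℝ) (Set.Ici 0) :=
        hg.comp (f := fun t : ℝ => t + t) (by fun_prop) fun t ht => Set.mem_Ici.2 (add_nonneg ht ht)
      have hg2 : ContinuousOn (fun t => ⟪S (t + s) (Q x), x⟫_ℝ) (Set.Ici 0) :=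
        hg.comp (f := fun t : ℝ => t + s) (by fun_prop) fun t ht => Set.mem_Ici.2 (add_nonneg ht hs)
      have hlim : Tendsto (fun t => ‖T t (R x) - T s (R x)‖ ^ 2) (𝓝[Set.Ici 0] s) (𝓝 0) := by
        have h1 := ((hg1 s hs).sub ((hg2 s hs).const_smul (2 : ℝ))).add
          (continuousWithinAt_const (b := ⟪S (s + s) (Q x), x⟫_ℝ))
        have h2 : Tendsto (fun t => ⟪S (t + t) (Q x), x⟫_ℝ - 2 * ⟪S (t + s) (Q x), x⟫_ℝ +
            ⟪S (s + s) (Q x), x⟫_ℝ) (𝓝[Set.Ici 0] s) (𝓝 (⟪S (s + s) (Q x), x⟫_ℝ -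
            2 * ⟪S (s + s) (Q x), x⟫_ℝ + ⟪S (s + s) (Q x), x⟫_ℝ)) := h1
        rw [show ⟪S (s + s) (Q x), x⟫_ℝ - 2 * ⟪S (s + s) (Q x), x⟫_ℝ + ⟪S (s + s) (Q x), x⟫_ℝ = 0
          by ring] at h2
        exact h2.congr' (eventually_nhdsWithin_of_forall fun t ht => (hd t ht).symm)
      rw [ContinuousWithinAt, tendsto_iff_norm_sub_tendsto_zero]
      have h3 := (Real.continuous_sqrt.tendsto 0).comp hlim
      simpa [Function.comp_def, Real.sqrt_sq (norm_nonneg _)] using h3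
    · refine lt_of_le_of_lt ?_ hx
      rw [dist_eq_norm, dist_eq_norm, ← map_sub]
      exact hTn t ht _
  · intro y z
    have h : ∀ x v, ⟪T t (R x), R v⟫_ℝ = ⟪R x, T t (R v)⟫_ℝ := fun x v => by
      rw [hTR t ht, hTR t ht, inner_sqrtOp_sqrtOp hQ, inner_sqrtOp_sqrtOp hQ, 
        hQ.inner_left_eq_inner_right, ContinuousLinearMap.adjoint_inner_left, hQS t ht,
        ← hQ.inner_left_eq_inner_right]
    have h1 : ∀ x z, ⟪T t (R x), z⟫_ℝ = ⟪R x, T t z⟫_ℝ := fun x => congrFun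
      (hdense.equalizer (by fun_prop) (by fun_prop) (funext fun v => h x v))
    exact congrFun (hdense.equalizer (g := fun y => ⟪T t y, z⟫_ℝ) (h := fun y => ⟪y, T t z⟫_ℝ)
      (by fun_prop) (by fun_prop) (funext fun x => h1 x z)) y

/-- The operator-theoretic core: symmetry of every `S(t) Q_∞` is equivalent to `S_Q` being a
symmetric contraction semigroup. -/
theorem symm_covInfty_iff {S : ℝ → H →L[ℝ] H} (hS : IsC0Semigroup S) {Q : H →L[ℝ] H}
    (hQ : Q.IsPositive)
    (htrace : ∫⁻ s in Set.Ioi (0 : ℝ), posTrace (S s * Q * (S s).adjoint) < ∞)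
    (hinj : Function.Injective (covInfty S Q)) :
    (∀ t, 0 ≤ t → ∀ x y,
      ⟪covInfty S Q x, (S t).adjoint y⟫_ℝ = ⟪covInfty S Q y, (S t).adjoint x⟫_ℝ) ↔
      Function.Injective Q ∧
      (∀ t, 0 ≤ t → Set.MapsTo (S t) (Set.range (sqrtOp Q)) (Set.range (sqrtOp Q))) ∧
      IsSymmContractionSemigroup (SQ S Q) := by
  constructor
  · intro hsymm
    have hQS : ∀ r, 0 ≤ r → ∀ x, S r (Q x) = Q ((S r).adjoint x) := fun r hr x =>
      semigroup_Q_comm hS hQ htrace hsymm hr x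
    have hQinj := injective_of_comm hQS hinj
    obtain ⟨T, hRT, hT⟩ := exists_symmContraction hS hQ htrace hQS hQinj
    refine ⟨hQinj, ?_, T, fun t ht x => ?_, hT⟩
    · rintro t ht _ ⟨x, rfl⟩
      exact ⟨T t x, hRT t ht x⟩
    · rw [SQ, ← hRT t ht, sqrtInv_sqrtOp hQ hQinj]
  · rintro ⟨hQinj, hmaps, T, hTF, -, hTsymm, -⟩
    have hRT : ∀ t, 0 ≤ t → ∀ x, sqrtOp Q (T t x) = S t (sqrtOp Q x) := fun t ht x => by
      rw [hTF t ht]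
      exact Function.invFun_eq (hmaps t ht ⟨x, rfl⟩)
    have hTR : ∀ t, 0 ≤ t → ∀ x, T t (sqrtOp Q x) = sqrtOp Q ((S t).adjoint x) := fun t ht x =>
      ext_inner_right ℝ fun v => by
        have h1 := hTsymm t ht (sqrtOp Q x) v
        simp only [ContinuousLinearMap.coe_coe] at h1
        rw [h1, sqrtOp_inner hQ, hRT t ht, sqrtOp_inner hQ,
          ContinuousLinearMap.adjoint_inner_left]
    refine fun t ht x y => inner_covInfty_adjoint_comm hS hQ htrace (fun r hr x => ?_) ht x y
    rw [← sqrtOp_sqrtOp hQ, ← hRT r hr, hTR r hr, sqrtOp_sqrtOp hQ]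

end Operators

/-! ### The Wiener integral is Gaussian -/

section WienerIntegral

variable {Ω : Type*} [MeasurableSpace Ω] {P : Measure Ω} {W : ℝ≥0 → H → Ω → ℝ}

theorem StepFun.memLp (φ : StepFun H) :
    MemLp φ.toFun 2 (volume.restrict (Set.Ioi (0 : ℝ))) := by
  unfold StepFun.toFun
  refine memLp_finsetSum _ fun i _ => ?_
  refine memLp_indicator_const 2 measurableSet_Ioc _ (Or.inr ?_)
  exact ((Measure.restrict_apply_le _ _).trans_lt (by simp [Real.volume_Ioc])).ne

theorem volume_real_Ioc_inter_Ioc {a b c d : ℝ} (hab : a ≤ b) (hcd : c ≤ d) :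
    volume.real (Set.Ioc a b ∩ Set.Ioc c d) =
      min b d - min b c - (min a d - min a c) := by
  rw [Set.Ioc_inter_Ioc, Measure.real, Real.volume_Ioc, ENNReal.toReal_ofReal']
  simp only [max_def, min_def]
  split_ifs <;> linarith

theorem StepFun.integral_norm_sq (φ : StepFun H) :
    ∫ s in Set.Ioi (0 : ℝ), ‖φ.toFun s‖ ^ 2 = ∑ i, ∑ j,
      (((min (φ.right i) (φ.right j) : ℝ≥0) : ℝ) - (min (φ.right i) (φ.left j) : ℝ≥0) -
        ((min (φ.left i) (φ.right j) : ℝ≥0) - (min (φ.left i) (φ.left j) : ℝ≥0))) *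
        ⟪φ.val i, φ.val j⟫_ℝ := by
  have h1 : ∀ s, ‖φ.toFun s‖ ^ 2 = ∑ i, ∑ j,
      (Set.Ioc (φ.left i : ℝ) (φ.right i) ∩ Set.Ioc (φ.left j : ℝ) (φ.right j)).indicator
        (fun _ => ⟪φ.val i, φ.val j⟫_ℝ) s := by
    intro s
    rw [← real_inner_self_eq_norm_sq, StepFun.toFun, sum_inner]
    refine Finset.sum_congr rfl fun i _ => ?_
    rw [inner_sum]
    refine Finset.sum_congr rfl fun j _ => ?_
    by_cases hi : s ∈ Set.Ioc (φ.left i : ℝ) (φ.right i) <;>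
    by_cases hj : s ∈ Set.Ioc (φ.left j : ℝ) (φ.right j) <;>
    simp [Set.indicator, hi, hj, -Set.mem_Ioc]
  have hsub : ∀ i j, Set.Ioc (φ.left i : ℝ) (φ.right i) ∩ Set.Ioc (φ.left j : ℝ) (φ.right j) ⊆
      Set.Ioi 0 := fun i j s hs => lt_of_le_of_lt (φ.left i).2 hs.1.1
  have hmeas : ∀ i j, MeasurableSet
      (Set.Ioc (φ.left i : ℝ) (φ.right i) ∩ Set.Ioc (φ.left j : ℝ) (φ.right j)) :=
    fun i j => measurableSet_Ioc.inter measurableSet_Ioc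
  have hfin : ∀ i j, volume
      (Set.Ioc (φ.left i : ℝ) (φ.right i) ∩ Set.Ioc (φ.left j : ℝ) (φ.right j)) < ∞ :=
    fun i j => (measure_mono Set.inter_subset_left).trans_lt (by simp [Real.volume_Ioc])
  have hint : ∀ i j, Integrable
      ((Set.Ioc (φ.left i : ℝ) (φ.right i) ∩ Set.Ioc (φ.left j : ℝ) (φ.right j)).indicator
        (fun _ => ⟪φ.val i, φ.val j⟫_ℝ)) (volume.restrict (Set.Ioi (0 : ℝ))) := fun i j =>
    ((integrable_indicator_iff (hmeas i j)).2 (integrableOn_const (hfin i j).ne)).mono_measure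
      Measure.restrict_le_self
  simp_rw [h1]
  rw [integral_finsetSum _ fun i _ => integrable_finsetSum _ fun j _ => hint i j]
  refine Finset.sum_congr rfl fun i _ => ?_
  rw [integral_finsetSum _ fun j _ => hint i j]
  refine Finset.sum_congr rfl fun j _ => ?_
  rw [integral_indicator_const _ (hmeas i j), measureReal_restrict_apply (hmeas i j),
    Set.inter_eq_left.2 (hsub i j),
    volume_real_Ioc_inter_Ioc (NNReal.coe_le_coe.2 (φ.le i)) (NNReal.coe_le_coe.2 (φ.le j))]
  simp

theorem StepFun.hasGaussianLaw_integral (hW : IsCylindricalWiener W P) (φ : StepFun H) :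
    HasGaussianLaw (φ.integral W) P := by
  have h := ((hW.isGaussianProcess.comp_right (S := Fin φ.n ⊕ Fin φ.n)
    (Sum.elim (fun i => (φ.right i, φ.val i)) fun i => (φ.left i, φ.val i))).smul
    (Sum.elim (fun _ => 1) fun _ => -1)).hasGaussianLaw_fun_sum (I := Finset.univ)
  convert! h using 2 with ω
  simp [StepFun.integral, Finset.sum_sub_distrib, ← sub_eq_add_neg]

theorem StepFun.integral_integral (hW : IsCylindricalWiener W P) (φ : StepFun H) :
    ∫ ω, φ.integral W ω ∂P = 0 := by
  have hi : ∀ t h, Integrable (W t h) P := fun t h =>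
    (hW.isGaussianProcess.hasGaussianLaw_eval (t, h)).integrable
  have hd : ∀ i ∈ Finset.univ, Integrable
      (fun ω => W (φ.right i) (φ.val i) ω - W (φ.left i) (φ.val i) ω) P :=
    fun i _ => (hi _ _).sub (hi _ _)
  simp only [StepFun.integral]
  rw [integral_finsetSum _ hd]
  refine Finset.sum_eq_zero fun i _ => ?_
  rw [integral_sub (hi _ _) (hi _ _), hW.mean, hW.mean, sub_zero]

/-- The Itô isometry for step functions. -/
theorem StepFun.variance_integral [IsProbabilityMeasure P] (hW : IsCylindricalWiener W P)
    (φ : StepFun H) :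
    Var[φ.integral W; P] = ∫ s in Set.Ioi (0 : ℝ), ‖φ.toFun s‖ ^ 2 := by
  have hL : ∀ t h, MemLp (W t h) 2 P := fun t h =>
    (hW.isGaussianProcess.hasGaussianLaw_eval (t, h)).memLp_two
  have hae : AEMeasurable (φ.integral W) P := (φ.hasGaussianLaw_integral hW).aemeasurable
  have e : φ.integral W = fun ω =>
      ∑ i, (W (φ.right i) (φ.val i) ω - W (φ.left i) (φ.val i) ω) := rfl
  have hd : ∀ i, MemLp
      (fun ω => W (φ.right i) (φ.val i) ω - W (φ.left i) (φ.val i) ω) 2 P :=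
    fun i => (hL _ _).sub (hL _ _)
  rw [← covariance_self hae, e, φ.integral_norm_sq, covariance_fun_sum_fun_sum hd hd]
  refine Finset.sum_congr rfl fun i _ => Finset.sum_congr rfl fun j _ => ?_
  rw [covariance_fun_sub_fun_sub (hL _ _) (hL _ _) (hL _ _) (hL _ _), hW.cov, hW.cov, hW.cov,
    hW.cov]
  ring

theorem StepFun.integral_exp [IsProbabilityMeasure P] (hW : IsCylindricalWiener W P)
    (φ : StepFun H) :
    ∫ ω, Complex.exp (φ.integral W ω * Complex.I) ∂P =
      Complex.exp (-((∫ s in Set.Ioi (0 : ℝ), ‖φ.toFun s‖ ^ 2 : ℝ) : ℂ) / 2) := by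
  have hG := φ.hasGaussianLaw_integral hW
  have h := hG.charFun_map_eq 1
  rw [charFun_apply, integral_map hG.aemeasurable (by fun_prop)] at h
  simp only [RCLike.inner_apply, conj_trivial, one_mul, mul_one] at h
  rw [h]
  have h1 : P[fun ω => φ.integral W ω] = 0 := φ.integral_integral hW
  have h2 : Var[fun ω => φ.integral W ω; P] = _ := φ.variance_integral hW
  rw [h1, h2]
  congr 1
  push_cast
  ring

theorem norm_sq_toLp {α : Type*} [MeasurableSpace α] {ν : Measure α} {f : α → H}
    (hf : MemLp f 2 ν) : ‖hf.toLp f‖ ^ 2 = ∫ a, ‖f a‖ ^ 2 ∂ν := by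
  rw [← real_inner_self_eq_norm_sq, L2.inner_def]
  refine integral_congr_ae ?_
  filter_upwards [hf.coeFn_toLp] with a ha
  rw [ha, real_inner_self_eq_norm_sq]

/-- A Wiener integral `∫ ⟨f, dW⟩` is a centered Gaussian variable with variance `∫ ‖f‖²`. -/
theorem IsWienerIntegral.integral_exp [IsProbabilityMeasure P] (hW : IsCylindricalWiener W P)
    {f : ℝ → H} {X : Ω → ℝ} (hf : AEStronglyMeasurable f (volume.restrict (Set.Ioi (0 : ℝ))))
    (hX : AEMeasurable X P) (h : IsWienerIntegral W P f X) :
    ∫ ω, Complex.exp (X ω * Complex.I) ∂P =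
      Complex.exp (-((∫ s in Set.Ioi (0 : ℝ), ‖f s‖ ^ 2 : ℝ) : ℂ) / 2) := by
  obtain ⟨φ, h1, h2⟩ := h
  have hfL : MemLp f 2 (volume.restrict (Set.Ioi (0 : ℝ))) := by
    obtain ⟨n, hn⟩ := (h1.eventually_lt_const ENNReal.zero_lt_top).exists
    have hd : MemLp (fun s => (φ n).toFun s - f s) 2 (volume.restrict (Set.Ioi (0 : ℝ))) :=
      ⟨(φ n).memLp.1.sub hf, hn⟩
    have := (φ n).memLp.sub hd
    refine this.ae_eq (ae_of_all _ fun s => ?_)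
    simp
  have hV : Tendsto (fun n => ∫ s in Set.Ioi (0 : ℝ), ‖(φ n).toFun s‖ ^ 2) atTop
      (𝓝 (∫ s in Set.Ioi (0 : ℝ), ‖f s‖ ^ 2)) := by
    have h3 : Tendsto (fun n => (φ n).memLp.toLp (φ n).toFun) atTop (𝓝 (hfL.toLp f)) :=
      (Lp.tendsto_Lp_iff_tendsto_eLpNorm'' _ (fun n => (φ n).memLp) f hfL).2 h1
    have h4 := (h3.norm).pow 2
    simp_rw [norm_sq_toLp] at h4
    exact h4
  -- convergence in `L²(P)` gives almost sure convergence along a subsequence, which is enough to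
  -- pass to the limit under the bounded exponential
  have hm : TendstoInMeasure P (fun n => (φ n).integral W) atTop X :=
    tendstoInMeasure_of_tendsto_eLpNorm two_ne_zero
      (fun n => ((φ n).hasGaussianLaw_integral hW).aemeasurable.aestronglyMeasurable)
      hX.aestronglyMeasurable h2
  obtain ⟨ns, hns, hlim⟩ := hm.exists_seq_tendsto_ae
  have h5 : Tendsto (fun k => ∫ ω, Complex.exp ((φ (ns k)).integral W ω * Complex.I) ∂P) atTop
      (𝓝 (∫ ω, Complex.exp (X ω * Complex.I) ∂P)) := by
    refine tendsto_integral_of_dominated_convergence (fun _ => 1) (fun k => ?_)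
      (integrable_const _) (fun k => ae_of_all _ fun ω => ?_) ?_
    · have := ((φ (ns k)).hasGaussianLaw_integral hW).aemeasurable
      exact AEMeasurable.aestronglyMeasurable (by fun_prop)
    · rw [Complex.norm_exp_ofReal_mul_I]
    · filter_upwards [hlim] with ω hω
      exact (Complex.continuous_exp.comp (by fun_prop :
        Continuous fun x : ℝ => (x : ℂ) * Complex.I)).continuousAt.tendsto.comp hω
  refine tendsto_nhds_unique h5 ?_
  simp_rw [StepFun.integral_exp hW]
  exact (Complex.continuous_exp.comp (by fun_prop :
    Continuous fun x : ℝ => -(x : ℂ) / 2)).continuousAt.tendsto.comp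
      (hV.comp hns.tendsto_atTop)

end WienerIntegral

/-! ### The joint law of `(X, A X + Y)` with `X ∼ μ` and `Y ∼ ν` independent -/

section JointLaw

variable [TopologicalSpace.SeparableSpace H] [MeasurableSpace H] [BorelSpace H]

/-- The law on `H × H` of `(X, A X + Y)`, where `X` and `Y` are independent with laws `μ`
and `ν`. -/
noncomputable def jointLaw (μ ν : Measure H) (A : H →L[ℝ] H) : Measure (H × H) :=
  (μ.prod ν).map fun p => (p.1, A p.1 + p.2)

variable {μ ν : Measure H} [IsProbabilityMeasure μ] [IsProbabilityMeasure ν] {A : H →L[ℝ] H}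

theorem measurable_jointMap (A : H →L[ℝ] H) :
    Measurable fun p : H × H => (p.1, A p.1 + p.2) := by
  have : SecondCountableTopology H := UniformSpace.secondCountable_of_separable H
  fun_prop

instance : IsProbabilityMeasure (jointLaw μ ν A) :=
  Measure.isProbabilityMeasure_map (measurable_jointMap A).aemeasurable

theorem measurePreserving_fst_jointLaw : MeasurePreserving Prod.fst (jointLaw μ ν A) μ := by
  refine ⟨measurable_fst, ?_⟩
  rw [jointLaw, Measure.map_map measurable_fst (measurable_jointMap A)]
  exact measurePreserving_fst.map_eq

theorem integral_exp_jointLaw (h k : H) :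
    ∫ p, Complex.exp (((⟪p.1, h⟫_ℝ + ⟪p.2, k⟫_ℝ : ℝ) : ℂ) * Complex.I) ∂(jointLaw μ ν A) =
      charFun μ (h + A.adjoint k) * charFun ν k := by
  have : SecondCountableTopology H := UniformSpace.secondCountable_of_separable H
  rw [jointLaw, integral_map (measurable_jointMap A).aemeasurable
    (Measurable.aestronglyMeasurable (by fun_prop)), charFun_apply, charFun_apply,
    ← integral_prod_mul]
  refine integral_congr_ae (ae_of_all _ fun p => ?_)
  simp only
  rw [← Complex.exp_add, inner_add_left, inner_add_right, ContinuousLinearMap.adjoint_inner_right]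
  congr 1
  push_cast
  ring

/-- Uniqueness of characteristic functions on `H × H`. -/
theorem ext_of_integral_exp {m m' : Measure (H × H)} [IsFiniteMeasure m] [IsFiniteMeasure m']
    (hmm : ∀ h k : H,
      ∫ p, Complex.exp (((⟪p.1, h⟫_ℝ + ⟪p.2, k⟫_ℝ : ℝ) : ℂ) * Complex.I) ∂m =
      ∫ p, Complex.exp (((⟪p.1, h⟫_ℝ + ⟪p.2, k⟫_ℝ : ℝ) : ℂ) * Complex.I) ∂m') : m = m' := by
  have : SecondCountableTopology H := UniformSpace.secondCountable_of_separable H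
  refine (MeasurableEquiv.toLp 2 (H × H)).map_measurableEquiv_injective
    (Measure.ext_of_charFun (funext fun t => ?_))
  rw [charFun_apply, charFun_apply, integral_map_equiv, integral_map_equiv]
  simpa [WithLp.prod_inner_apply] using hmm t.fst t.snd

/-- Averaging over the second variable of the joint law. -/
theorem integral_jointLaw {φ ψ : H → ℝ} (hψ : Integrable ψ μ) (hφ : Measurable φ)
    (hφb : ∃ C, ∀ x, |φ x| ≤ C) :
    ∫ p, ψ p.1 * φ p.2 ∂(jointLaw μ ν A) = ∫ x, ψ x * ∫ y, φ (A x + y) ∂ν ∂μ := by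
  have : SecondCountableTopology H := UniformSpace.secondCountable_of_separable H
  obtain ⟨C, hC⟩ := hφb
  have hψ' : AEStronglyMeasurable (fun p : H × H => ψ p.1) (jointLaw μ ν A) :=
    (measurePreserving_fst_jointLaw.integrable_comp_of_integrable hψ).1
  have hm : AEStronglyMeasurable (fun p : H × H => ψ p.1 * φ p.2) (jointLaw μ ν A) :=
    hψ'.mul (hφ.comp measurable_snd).aestronglyMeasurable
  have hi : Integrable (fun p : H × H => ψ p.1 * φ p.2) (jointLaw μ ν A) :=
    (measurePreserving_fst_jointLaw.integrable_comp_of_integrable hψ).mul_bdd (c := C)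
      (hφ.comp measurable_snd).aestronglyMeasurable (ae_of_all _ fun p => hC p.2)
  have hi' : Integrable (fun p : H × H => ψ p.1 * φ (A p.1 + p.2)) (μ.prod ν) :=
    (integrable_map_measure hm (measurable_jointMap A).aemeasurable).1 hi
  rw [jointLaw, integral_map (measurable_jointMap A).aemeasurable hm, integral_prod _ hi']
  refine integral_congr_ae (ae_of_all _ fun x => ?_)
  simp only
  rw [integral_const_mul]

theorem measurable_integral_translate {φ : H → ℝ} (hφ : Measurable φ) :
    Measurable fun x => ∫ y, φ (A x + y) ∂ν := by
  have : SecondCountableTopology H := UniformSpace.secondCountable_of_separable H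
  have h : Measurable fun p : H × H => φ (A p.1 + p.2) := by fun_prop
  exact h.stronglyMeasurable.integral_prod_right'.measurable

theorem abs_integral_translate_le {φ : H → ℝ} {C : ℝ} (hC : ∀ x, |φ x| ≤ C) (x : H) :
    |∫ y, φ (A x + y) ∂ν| ≤ C := by
  simpa using norm_integral_le_of_norm_le_const (μ := ν) (f := fun y => φ (A x + y))
    (ae_of_all _ fun y => hC _)

theorem memLp_of_bounded {φ : H → ℝ} (hφ : Measurable φ) {C : ℝ} (hC : ∀ x, |φ x| ≤ C) :
    MemLp φ 2 μ :=
  MemLp.of_bound hφ.aestronglyMeasurable C (ae_of_all _ hC)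

/-- If the joint law is exchangeable, then averaging over the second variable defines a bounded
symmetric operator on `L²(μ)`: it is `J₁* J₂`, where `J₁` and `J₂` are the isometric embeddings of
`L²(μ)` into `L²` of the joint law given by the two projections. -/
theorem exists_symmetric_operator
    (hswap : (jointLaw μ ν A).map Prod.swap = jointLaw μ ν A) :
    ∃ T : Lp ℝ 2 μ →L[ℝ] Lp ℝ 2 μ,
      (∀ φ : H → ℝ, Measurable φ → (∃ C, ∀ x, |φ x| ≤ C) →
        ∀ f : Lp ℝ 2 μ, f =ᵐ[μ] φ → T f =ᵐ[μ] fun x => ∫ y, φ (A x + y) ∂ν) ∧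
      (T : Lp ℝ 2 μ →ₗ[ℝ] Lp ℝ 2 μ).IsSymmetric := by
  have h1 : MeasurePreserving Prod.fst (jointLaw μ ν A) μ := measurePreserving_fst_jointLaw
  have hsw : MeasurePreserving Prod.swap (jointLaw μ ν A) (jointLaw μ ν A) :=
    ⟨measurable_swap, hswap⟩
  have h2 : MeasurePreserving Prod.snd (jointLaw μ ν A) μ := h1.comp hsw
  set J₁ : Lp ℝ 2 μ →L[ℝ] Lp ℝ 2 (jointLaw μ ν A) :=
    (Lp.compMeasurePreservingₗᵢ ℝ Prod.fst h1).toContinuousLinearMap with hJ₁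
  set J₂ : Lp ℝ 2 μ →L[ℝ] Lp ℝ 2 (jointLaw μ ν A) :=
    (Lp.compMeasurePreservingₗᵢ ℝ Prod.snd h2).toContinuousLinearMap with hJ₂
  have hinner : ∀ f g : Lp ℝ 2 μ, ⟪J₁ f, J₂ g⟫_ℝ = ∫ p, f p.1 * g p.2 ∂(jointLaw μ ν A) := by
    intro f g
    rw [L2.inner_def]
    refine integral_congr_ae ?_
    filter_upwards [Lp.coeFn_compMeasurePreserving f h1, Lp.coeFn_compMeasurePreserving g h2]
      with p hp1 hp2
    change ⟪(Lp.compMeasurePreserving Prod.fst h1 f : H × H → ℝ) p,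
      (Lp.compMeasurePreserving Prod.snd h2 g : H × H → ℝ) p⟫_ℝ = _
    rw [hp1, hp2]
    simp [mul_comm]
  have hsymm : ∀ f g : Lp ℝ 2 μ, ⟪J₁ f, J₂ g⟫_ℝ = ⟪J₁ g, J₂ f⟫_ℝ := by
    intro f g
    rw [hinner, hinner]
    have := (show MeasurePreserving (MeasurableEquiv.prodComm : H × H ≃ᵐ H × H)
      (jointLaw μ ν A) (jointLaw μ ν A) from hsw).integral_comp'
        (fun p : H × H => f p.1 * g p.2)
    rw [← this]
    exact integral_congr_ae (ae_of_all _ fun p => mul_comm (f p.2) (g p.1))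
  refine ⟨J₁.adjoint ∘L J₂, fun φ hφ hφb f hf => ?_, fun f g => ?_⟩
  · obtain ⟨C, hC⟩ := hφb
    have hg : MemLp (fun x => ∫ y, φ (A x + y) ∂ν) 2 μ :=
      memLp_of_bounded (measurable_integral_translate hφ) (abs_integral_translate_le hC)
    suffices hT : (J₁.adjoint ∘L J₂) f = hg.toLp _ by
      rw [hT]; exact hg.coeFn_toLp
    refine ext_inner_left ℝ fun v => ?_
    rw [ContinuousLinearMap.comp_apply, ContinuousLinearMap.adjoint_inner_right, hinner]
    have hv : Integrable v μ := (Lp.memLp v).integrable one_le_two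
    have e1 : ∫ p, v p.1 * f p.2 ∂(jointLaw μ ν A) = ∫ p, v p.1 * φ p.2 ∂(jointLaw μ ν A) := by
      refine integral_congr_ae ?_
      filter_upwards [h2.quasiMeasurePreserving.ae_eq_comp hf] with p hp
      simp only [Function.comp_apply] at hp
      rw [hp]
    rw [e1, integral_jointLaw hv hφ ⟨C, hC⟩, L2.inner_def]
    refine integral_congr_ae ?_
    filter_upwards [hg.coeFn_toLp] with x hx
    rw [hx]
    simp [mul_comm]
  · simp only [ContinuousLinearMap.coe_coe, ContinuousLinearMap.comp_apply]
    rw [ContinuousLinearMap.adjoint_inner_left, ContinuousLinearMap.adjoint_inner_right,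
      real_inner_comm, hsymm]

/-- Conversely, if averaging over the second variable is given by a symmetric operator on `L²(μ)`,
then the joint law is exchangeable. -/
theorem jointLaw_swap {T : Lp ℝ 2 μ →L[ℝ] Lp ℝ 2 μ}
    (hT : ∀ φ : H → ℝ, Measurable φ → (∃ C, ∀ x, |φ x| ≤ C) →
        ∀ f : Lp ℝ 2 μ, f =ᵐ[μ] φ → T f =ᵐ[μ] fun x => ∫ y, φ (A x + y) ∂ν)
    (hsymm : (T : Lp ℝ 2 μ →ₗ[ℝ] Lp ℝ 2 μ).IsSymmetric) :
    (jointLaw μ ν A).map Prod.swap = jointLaw μ ν A := by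
  have key : ∀ φ ψ : H → ℝ, Measurable φ → Measurable ψ → (∀ x, |φ x| ≤ 1) → (∀ x, |ψ x| ≤ 1) →
      ∫ p, ψ p.1 * φ p.2 ∂(jointLaw μ ν A) = ∫ p, φ p.1 * ψ p.2 ∂(jointLaw μ ν A) := by
    have hk : ∀ φ ψ : H → ℝ, ∀ (hφ : MemLp φ 2 μ) (hψ : MemLp ψ 2 μ), Measurable φ →
        (∀ x, |φ x| ≤ 1) → ∫ p, ψ p.1 * φ p.2 ∂(jointLaw μ ν A) =
          ⟪hψ.toLp ψ, T (hφ.toLp φ)⟫_ℝ := by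
      intro φ ψ hφ hψ hφm hφ1
      rw [integral_jointLaw (hψ.integrable one_le_two) hφm ⟨1, hφ1⟩, L2.inner_def]
      refine integral_congr_ae ?_
      filter_upwards [hψ.coeFn_toLp, hT φ hφm ⟨1, hφ1⟩ _ hφ.coeFn_toLp] with x hx1 hx2
      rw [hx1, hx2]
      simp [mul_comm]
    intro φ ψ hφ hψ hφ1 hψ1
    have hφL : MemLp φ 2 μ := memLp_of_bounded hφ hφ1
    have hψL : MemLp ψ 2 μ := memLp_of_bounded hψ hψ1
    rw [hk φ ψ hφL hψL hφ hφ1, hk ψ φ hψL hφL hψ hψ1, real_inner_comm]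
    exact hsymm _ _
  have : IsProbabilityMeasure ((jointLaw μ ν A).map Prod.swap) :=
    Measure.isProbabilityMeasure_map measurable_swap.aemeasurable
  refine Measure.ext_prod fun {s t} hs ht => ?_
  rw [Measure.map_apply measurable_swap (hs.prod ht), Set.preimage_swap_prod]
  have hind : ∀ s t : Set H, MeasurableSet s → MeasurableSet t →
      (jointLaw μ ν A).real (s ×ˢ t) =
        ∫ p, s.indicator 1 p.1 * t.indicator 1 p.2 ∂(jointLaw μ ν A) := by
    intro s t hs ht
    rw [← integral_indicator_one (hs.prod ht)]
    refine integral_congr_ae (ae_of_all _ fun p => ?_)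
    by_cases h1 : p.1 ∈ s <;> by_cases h2 : p.2 ∈ t <;> simp [Set.indicator, h1, h2]
  have hb : ∀ s : Set H, ∀ x, |s.indicator (1 : H → ℝ) x| ≤ 1 := fun s x => by
    by_cases h : x ∈ s <;> simp [h]
  have h := key (s.indicator 1) (t.indicator 1) (measurable_one.indicator hs)
    (measurable_one.indicator ht) (hb s) (hb t)
  rw [← hind t s ht hs, ← hind s t hs ht] at h
  exact (measureReal_eq_measureReal_iff).1 h

end JointLaw

/-! ### The laws of the Ornstein–Uhlenbeck process -/

section Law

variable [TopologicalSpace.SeparableSpace H] [MeasurableSpace H] [BorelSpace H]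

theorem IsCenteredGaussian.inner_cov {μ : Measure H} {C : H → H} (hμ : IsCenteredGaussian μ C)
    (x y : H) : ⟪C x, y⟫_ℝ = covarianceBilin μ x y := by
  have : SecondCountableTopology H := UniformSpace.secondCountable_of_separable H
  have := hμ.isGaussian
  rw [← hμ.cov, covarianceOperator_inner IsGaussian.memLp_two_id,
    covarianceBilin_apply IsGaussian.memLp_two_id]
  simp only [id, hμ.mean, sub_zero]

theorem IsCenteredGaussian.charFun {μ : Measure H} {C : H → H} (hμ : IsCenteredGaussian μ C)
    (h : H) : MeasureTheory.charFun μ h = Complex.exp (-(⟪C h, h⟫_ℝ : ℂ) / 2) := by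
  have : SecondCountableTopology H := UniformSpace.secondCountable_of_separable H
  have := hμ.isGaussian
  rw [IsGaussian.charFun_eq', hμ.inner_cov]
  simp only [id, hμ.mean, inner_zero_right]
  congr 1
  push_cast
  ring

variable {S : ℝ → H →L[ℝ] H} {Q : H →L[ℝ] H} {Ω : Type*} [MeasurableSpace Ω] {P : Measure Ω}
  [IsProbabilityMeasure P] {W : ℝ≥0 → H → Ω → ℝ} {Z : ℝ → H → Ω → H}

/-- `Z(t, x)` has the Gaussian law with mean `S(t) x` and covariance
`Q_∞ - S(t) Q_∞ S(t)*`. -/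
theorem charFun_map_ou (hS : IsC0Semigroup S) (hQ : Q.IsPositive)
    (htrace : ∫⁻ s in Set.Ioi (0 : ℝ), posTrace (S s * Q * (S s).adjoint) < ∞)
    (hW : IsCylindricalWiener W P) (hZ : IsOUProcess S Q W P Z) {t : ℝ} (ht : 0 ≤ t) (x h : H) :
    charFun (P.map (Z t x)) h = Complex.exp (-((⟪covInfty S Q h, h⟫_ℝ -
      ⟪covInfty S Q ((S t).adjoint h), (S t).adjoint h⟫_ℝ : ℝ) : ℂ) / 2) *
      Complex.exp (⟪S t x, h⟫_ℝ * Complex.I) := by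
  have hZm : AEMeasurable (Z t x) P := hZ.aemeasurable t ht x
  have hf : AEStronglyMeasurable
      ((Set.Ioc 0 t).indicator fun s => sqrtOp Q ((S (t - s)).adjoint h))
      (volume.restrict (Set.Ioi (0 : ℝ))) := by
    rw [aestronglyMeasurable_indicator_iff measurableSet_Ioc,
      Measure.restrict_restrict measurableSet_Ioc,
      Set.inter_eq_left.2 Set.Ioc_subset_Ioi_self]
    refine aestronglyMeasurable_of_inner fun y => ?_
    simp_rw [sqrtOp_inner hQ, ContinuousLinearMap.adjoint_inner_left]
    refine ContinuousOn.aestronglyMeasurable ?_ measurableSet_Ioc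
    exact continuousOn_const.inner ((hS.continuousOn _).comp
      (f := fun s : ℝ => t - s) (by fun_prop) fun s hs => Set.mem_Ici.2 (sub_nonneg.2 hs.2))
  have hX : AEMeasurable (fun ω => ⟪Z t x ω - S t x, h⟫_ℝ) P :=
    (show Measurable fun z : H => ⟪z - S t x, h⟫_ℝ from
      (by fun_prop : Continuous fun z : H => ⟪z - S t x, h⟫_ℝ).measurable).comp_aemeasurable hZm
  have key := (hZ.formula t ht x h).integral_exp hW hf hX
  have hvar : ∫ s in Set.Ioi (0 : ℝ),
      ‖(Set.Ioc 0 t).indicator (fun s => sqrtOp Q ((S (t - s)).adjoint h)) s‖ ^ 2 =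
      ⟪covInfty S Q h, h⟫_ℝ - ⟪covInfty S Q ((S t).adjoint h), (S t).adjoint h⟫_ℝ := by
    rw [← integral_Ioc_inner_conj hS hQ htrace ht]
    have e1 : (fun s => ‖(Set.Ioc 0 t).indicator
        (fun s => sqrtOp Q ((S (t - s)).adjoint h)) s‖ ^ 2) =
        (Set.Ioc 0 t).indicator
          fun s => ⟪Q ((S (t - s)).adjoint h), (S (t - s)).adjoint h⟫_ℝ := by
      funext s
      by_cases hs : s ∈ Set.Ioc 0 t
      · rw [Set.indicator_of_mem hs, Set.indicator_of_mem hs, ← inner_sqrtOp_sqrtOp hQ,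
          real_inner_self_eq_norm_sq]
      · rw [Set.indicator_of_notMem hs, Set.indicator_of_notMem hs]
        simp
    rw [e1, setIntegral_indicator measurableSet_Ioc, Set.inter_eq_right.2 Set.Ioc_subset_Ioi_self,
      ← intervalIntegral.integral_of_le ht, ← intervalIntegral.integral_of_le ht,
      intervalIntegral.integral_comp_sub_left
        (fun s => ⟪Q ((S s).adjoint h), (S s).adjoint h⟫_ℝ)]
    simp
  rw [hvar] at key
  rw [← key, charFun_apply, integral_map hZm
    (Continuous.aestronglyMeasurable (by fun_prop)), ← integral_mul_const]
  refine integral_congr_ae (ae_of_all _ fun ω => ?_)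
  simp only
  rw [← Complex.exp_add, inner_sub_left]
  congr 1
  push_cast
  ring

theorem map_ou_eq (hS : IsC0Semigroup S) (hQ : Q.IsPositive)
    (htrace : ∫⁻ s in Set.Ioi (0 : ℝ), posTrace (S s * Q * (S s).adjoint) < ∞)
    (hW : IsCylindricalWiener W P) (hZ : IsOUProcess S Q W P Z) {t : ℝ} (ht : 0 ≤ t) (x : H) :
    P.map (Z t x) = (P.map (Z t 0)).map fun y => S t x + y := by
  have : SecondCountableTopology H := UniformSpace.secondCountable_of_separable H
  have := Measure.isProbabilityMeasure_map (hZ.aemeasurable t ht x)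
  have := Measure.isProbabilityMeasure_map (hZ.aemeasurable t ht 0)
  refine Measure.ext_of_charFun (funext fun h => ?_)
  rw [charFun_map_const_add, charFun_map_ou hS hQ htrace hW hZ ht,
    charFun_map_ou hS hQ htrace hW hZ ht]
  simp

/-- The Mehler-type formula `R_t φ(x) = ∫ φ(S(t) x + y) ν_t(dy)`, where `ν_t` is the law of
`Z(t, 0)`. -/
theorem transition_eq (hS : IsC0Semigroup S) (hQ : Q.IsPositive)
    (htrace : ∫⁻ s in Set.Ioi (0 : ℝ), posTrace (S s * Q * (S s).adjoint) < ∞)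
    (hW : IsCylindricalWiener W P) (hZ : IsOUProcess S Q W P Z) {t : ℝ} (ht : 0 ≤ t)
    {φ : H → ℝ} (hφ : Measurable φ) :
    transition P Z t φ = fun x => ∫ y, φ (S t x + y) ∂(P.map (Z t 0)) := by
  funext x
  rw [transition, ← integral_map (hZ.aemeasurable t ht x) hφ.aestronglyMeasurable,
    map_ou_eq hS hQ htrace hW hZ ht x,
    integral_map (by fun_prop) hφ.aestronglyMeasurable]

/-- The law of `(X, Z(t, X))` is Gaussian with marginal covariances `Q_∞` and cross-covariance
`S(t) Q_∞`. The Lyapunov identity makes the second marginal equal to `μ`. -/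
theorem integral_exp_jointLaw_ou (hS : IsC0Semigroup S) (hQ : Q.IsPositive)
    (htrace : ∫⁻ s in Set.Ioi (0 : ℝ), posTrace (S s * Q * (S s).adjoint) < ∞)
    (hW : IsCylindricalWiener W P) (hZ : IsOUProcess S Q W P Z) {μ : Measure H}
    (hμ : IsCenteredGaussian μ (covInfty S Q)) {t : ℝ} (ht : 0 ≤ t) (h k : H) :
    ∫ p, Complex.exp (((⟪p.1, h⟫_ℝ + ⟪p.2, k⟫_ℝ : ℝ) : ℂ) * Complex.I)
        ∂(jointLaw μ (P.map (Z t 0)) (S t)) =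
      Complex.exp ((-(⟪covInfty S Q h, h⟫_ℝ + 2 * ⟪covInfty S Q h, (S t).adjoint k⟫_ℝ +
        ⟪covInfty S Q k, k⟫_ℝ) / 2 : ℝ) : ℂ) := by
  have := hμ.isGaussian
  have := Measure.isProbabilityMeasure_map (hZ.aemeasurable t ht 0)
  rw [integral_exp_jointLaw, hμ.charFun, charFun_map_ou hS hQ htrace hW hZ ht, map_zero,
    inner_zero_left, Complex.ofReal_zero, zero_mul, Complex.exp_zero, mul_one, ← Complex.exp_add]
  congr 1
  have hc : ⟪covInfty S Q ((S t).adjoint k), h⟫_ℝ = ⟪covInfty S Q h, (S t).adjoint k⟫_ℝ :=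
    inner_covInfty_comm hS hQ htrace _ _
  have hadd : ⟪covInfty S Q (h + (S t).adjoint k), h + (S t).adjoint k⟫_ℝ =
      ⟪covInfty S Q h, h⟫_ℝ + 2 * ⟪covInfty S Q h, (S t).adjoint k⟫_ℝ +
        ⟪covInfty S Q ((S t).adjoint k), (S t).adjoint k⟫_ℝ := by
    rw [← hμ.cov, map_add, hμ.cov, hμ.cov, inner_add_left, inner_add_right, inner_add_right, hc]
    ring
  rw [hadd]
  push_cast
  ring

/-- The joint law of `(X, Z(t, X))`, with `X ∼ μ` independent of the noise, is exchangeable if and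
only if its cross-covariance `S(t) Q_∞` is symmetric. -/
theorem jointLaw_swap_iff (hS : IsC0Semigroup S) (hQ : Q.IsPositive)
    (htrace : ∫⁻ s in Set.Ioi (0 : ℝ), posTrace (S s * Q * (S s).adjoint) < ∞)
    (hW : IsCylindricalWiener W P) (hZ : IsOUProcess S Q W P Z) {μ : Measure H}
    (hμ : IsCenteredGaussian μ (covInfty S Q)) {t : ℝ} (ht : 0 ≤ t) :
    (jointLaw μ (P.map (Z t 0)) (S t)).map Prod.swap = jointLaw μ (P.map (Z t 0)) (S t) ↔
      ∀ x y, ⟪covInfty S Q x, (S t).adjoint y⟫_ℝ = ⟪covInfty S Q y, (S t).adjoint x⟫_ℝ := by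
  have : SecondCountableTopology H := UniformSpace.secondCountable_of_separable H
  have := hμ.isGaussian
  have := Measure.isProbabilityMeasure_map (hZ.aemeasurable t ht 0)
  have hJ := integral_exp_jointLaw_ou hS hQ htrace hW hZ hμ ht
  set m := jointLaw μ (P.map (Z t 0)) (S t) with hm
  have hmswap : ∀ h k : H,
      ∫ p, Complex.exp (((⟪p.1, h⟫_ℝ + ⟪p.2, k⟫_ℝ : ℝ) : ℂ) * Complex.I) ∂(m.map Prod.swap) =
      ∫ p, Complex.exp (((⟪p.1, k⟫_ℝ + ⟪p.2, h⟫_ℝ : ℝ) : ℂ) * Complex.I) ∂m := by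
    intro h k
    rw [integral_map measurable_swap.aemeasurable
      (Continuous.aestronglyMeasurable (by fun_prop))]
    refine integral_congr_ae (ae_of_all _ fun p => ?_)
    simp only [Prod.fst_swap, Prod.snd_swap]
    rw [add_comm]
  constructor
  · intro hsw x y
    have h1 := hmswap x y
    rw [hsw, hJ, hJ, ← Complex.ofReal_exp, ← Complex.ofReal_exp, Complex.ofReal_inj,
      Real.exp_eq_exp] at h1
    linarith
  · intro hsymm
    have : IsProbabilityMeasure m := by rw [hm]; infer_instance
    have : IsProbabilityMeasure (m.map Prod.swap) :=
      Measure.isProbabilityMeasure_map measurable_swap.aemeasurable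
    refine ext_of_integral_exp fun h k => ?_
    rw [hmswap, hJ, hJ, hsymm k h]
    congr 2
    ring

/-- `(R_t)` is symmetric in `L²(μ)` if and only if `S(t) Q_∞` is symmetric for every `t ≥ 0`. -/
theorem isSymmetricInL2_iff (hS : IsC0Semigroup S) (hQ : Q.IsPositive)
    (htrace : ∫⁻ s in Set.Ioi (0 : ℝ), posTrace (S s * Q * (S s).adjoint) < ∞)
    (hW : IsCylindricalWiener W P) (hZ : IsOUProcess S Q W P Z) {μ : Measure H}
    (hμ : IsCenteredGaussian μ (covInfty S Q)) :
    IsSymmetricInL2 P Z μ ↔ ∀ t, 0 ≤ t → ∀ x y,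
      ⟪covInfty S Q x, (S t).adjoint y⟫_ℝ = ⟪covInfty S Q y, (S t).adjoint x⟫_ℝ := by
  have := hμ.isGaussian
  refine forall_congr' fun t => forall_congr' fun ht => ?_
  have := Measure.isProbabilityMeasure_map (hZ.aemeasurable t ht 0)
  rw [← jointLaw_swap_iff hS hQ htrace hW hZ hμ ht]
  constructor
  · rintro ⟨T, hT, hsymm⟩
    refine jointLaw_swap (T := T) (fun φ hφ hb f hf => ?_) hsymm
    rw [← transition_eq hS hQ htrace hW hZ ht hφ]
    exact hT φ hφ hb f hf
  · intro hsw
    obtain ⟨T, hT, hsymm⟩ := exists_symmetric_operator hsw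
    refine ⟨T, fun φ hφ hb f hf => ?_, hsymm⟩
    rw [transition_eq hS hQ htrace hW hZ ht hφ]
    exact hT φ hφ hb f hf

end Law

end OrnsteinUhlenbeck

theorem theorem2p6 {H : Type*} [NormedAddCommGroup H] [InnerProductSpace ℝ H] [CompleteSpace H]
    [TopologicalSpace.SeparableSpace H] [MeasurableSpace H] [BorelSpace H]
    (S : ℝ → H →L[ℝ] H) (hS : OrnsteinUhlenbeck.IsC0Semigroup S)
    (Q : H →L[ℝ] H) (hQ : Q.IsPositive)
    (htrace : ∫⁻ s in Set.Ioi (0 : ℝ),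
      OrnsteinUhlenbeck.posTrace (S s * Q * (S s).adjoint) < ∞)
    (hinj : Function.Injective (OrnsteinUhlenbeck.covInfty S Q))
    {Ω : Type*} [MeasurableSpace Ω] (P : Measure Ω) [IsProbabilityMeasure P]
    (W : ℝ≥0 → H → Ω → ℝ) (hW : OrnsteinUhlenbeck.IsCylindricalWiener W P)
    (Z : ℝ → H → Ω → H) (hZ : OrnsteinUhlenbeck.IsOUProcess S Q W P Z)
    (μ : Measure H)
    (hμ : OrnsteinUhlenbeck.IsCenteredGaussian μ (OrnsteinUhlenbeck.covInfty S Q)) :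
    OrnsteinUhlenbeck.IsSymmetricInL2 P Z μ ↔
      Function.Injective Q ∧
      (∀ t, 0 ≤ t → Set.MapsTo (S t) (Set.range (OrnsteinUhlenbeck.sqrtOp Q))
        (Set.range (OrnsteinUhlenbeck.sqrtOp Q))) ∧
      OrnsteinUhlenbeck.IsSymmContractionSemigroup (OrnsteinUhlenbeck.SQ S Q) := by
  exact (OrnsteinUhlenbeck.isSymmetricInL2_iff hS hQ htrace hW hZ hμ).trans
    (OrnsteinUhlenbeck.symm_covInfty_iff hS hQ htrace hinj)
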